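/- Let $\pi:M\to B$ be a smooth submersion of (Hausdorff, second countable, finite-dimensional) smooth manifolds with connected fibres, let $\mathrm{Ver}=\ker d\pi$, and let $\omega_V\in\Omega^2(\mathrm{Ver})$ be a nondegenerate vertical $2$-form with $d_V\omega_V=0$. An Ehresmann connection is a smooth splitting $TM=\mathrm{Ver}\oplus\mathrm{Hor}$; write $h(u)$ for the horizontal lift of $u\in\mathfrak X(B)$ and $C(u,v)=[h(u),h(v)]-h([u,v])$ for the curvature. The connection is called symplectic if $d_H\omega_V=0$, i.e. $L_{h(u)}\omega_V=0$ for all $u$; a symplectic connection is not required to be complete. Assume that $(M\to B,\omega_V)$ is a symplectic fibration, i.e. that at least one symplectic connection is complete (every smooth curve in $B$ has horizontal lifts defined for all times). On $\Omega^p(B,\Omega^q(\mathrm{Ver}))$ (alternating $C^\infty(B)$-multilinear maps from $\mathfrak X(B)^p$ to vertical $q$-forms) let $d_V$ be $(-1)^p$ times the fibrewise de Rham differential, let $d_H$ be the covariant exterior derivative $$(d_H\Lambda)(v_0,\dots,v_p)=\sum_i(-1)^iL_{h(v_i)}\bigl(\Lambda(\dots,\widehat{v_i},\dots)\bigr)+\sum_{i<j}(-1)^{i+j}\Lambda([v_i,v_j],\dots,\widehat{v_i},\dots,\widehat{v_j},\dots),$$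 and let $d_C$ be the contraction with the curvature; in particular $(d_C\omega_V)(u,v)=-i_{C(u,v)}\omega_V$. Let $E_1^{p,q}=\Omega^p(B,H^q(\mathrm{Ver}))$ be the cohomology of $d_V$, and let $E_2^{p,q}=H^p(B,H^q(\mathrm{Ver}))$ be the cohomology of $E_1^{\bullet,q}$ under the differential $[\Lambda]_1\mapsto[d_H\Lambda]_1$. Then: 1. The cocycles and the coboundaries in $E_1^{2,1}$, hence $H^2(B,H^1(\mathrm{Ver}))$, do not depend on the Ehresmann connection used to define $d_H$. 2. For every symplectic connection, $d_C\omega_V\in\Omega^2(B,\Omega^1(\mathrm{Ver}))$ is $d_V$-closed and $[d_C\omega_V]_1$ is a cocycle; the resulting class $[d_C\omega_V]_2\in H^2(B,H^1(\mathrm{Ver}))$ does not depend on the choice of the symplectic connection. 3. $[d_C\omega_V]_2=0$ if and only if there is a symplectic connection with hamiltonian curvature, i.e. a symplectic connection for which $d_C\omega_V+d_V\omega_H=0$ for some $\omega_H\in\Omega^2(B,C^\infty(M))$. -/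

import Mathlib

noncomputable section

set_option linter.unusedSectionVars false

open scoped Manifold ContDiff Topology
open VectorField Set

namespace SympFib

section

variable {E : Type*} [NormedAddCommGroup E] [NormedSpace ℝ E] [FiniteDimensional ℝ E]
  {F : Type*} [NormedAddCommGroup F] [NormedSpace ℝ F] [FiniteDimensional ℝ F]
  {M : Type*} [TopologicalSpace M] [ChartedSpace E M] [IsManifold 𝓘(ℝ, E) ∞ M]
  {B : Type*} [TopologicalSpace B] [ChartedSpace F B] [IsManifold 𝓘(ℝ, F) ∞ B]

/-- `C^∞(M)`. -/
abbrev Fn (E : Type*) [NormedAddCommGroup E] [NormedSpace ℝ E] (M : Type*) [TopologicalSpace M]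
    [ChartedSpace E M] : Type _ := C^∞⟮𝓘(ℝ, E), M; 𝓘(ℝ, ℝ), ℝ⟯

/-- Smooth vector fields on `M`. -/
abbrev VF (E : Type*) [NormedAddCommGroup E] [NormedSpace ℝ E] (M : Type*) [TopologicalSpace M]
    [ChartedSpace E M] [IsManifold 𝓘(ℝ, E) ∞ M] : Type _ :=
  Cₛ^∞⟮𝓘(ℝ, E); E, (TangentSpace 𝓘(ℝ, E) : M → Type _)⟯

/-- The derivative `V f = df(V)` of a smooth function along a vector field. -/
def VF.act (V : VF E M) (f : Fn E M) : Fn E M where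
  val x := mvfderiv 𝓘(ℝ, E) f x (V x)
  property := by
    have h1 := f.contMDiff.contMDiff_tangentMap (m := ∞) (by norm_num)
    exact (contMDiff_snd_tangentBundle_modelSpace ℝ 𝓘(ℝ, ℝ)).comp (h1.comp V.contMDiff)

/-- The product `f V` of a vector field by a smooth function. -/
def VF.fmul (f : Fn E M) (V : VF E M) : VF E M where
  toFun x := f x • V x
  contMDiff_toFun := f.contMDiff.smul_section V.contMDiff

/-- The Lie bracket of vector fields. -/
def VF.bracket (V W : VF E M) : VF E M where
  toFun := mlieBracket 𝓘(ℝ, E) V W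
  contMDiff_toFun := by
    have : IsManifold 𝓘(ℝ, E) ((∞ : WithTop ℕ∞) + 1) M := by
      simpa using (inferInstance : IsManifold 𝓘(ℝ, E) ∞ M)
    have : IsManifold 𝓘(ℝ, E) (minSmoothness ℝ 2) M := by
      rw [minSmoothness_of_isRCLikeNormedField]; infer_instance
    exact fun x => ContMDiffAt.mlieBracket_vectorField (n := ⊤) (m := ⊤) (V.contMDiff x) (W.contMDiff x)
      (by simp)

theorem VF.related_chart (p : M → B) (hp : ContMDiff 𝓘(ℝ, E) 𝓘(ℝ, F) ∞ p) (V : VF E M) (U : VF F B)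
    (hV : ∀ x, mfderiv 𝓘(ℝ, E) 𝓘(ℝ, F) p x (V x) = U (p x)) (x : M) :
    ∀ᶠ y in 𝓝 (extChartAt 𝓘(ℝ, E) x x),
      fderiv ℝ (writtenInExtChartAt 𝓘(ℝ, E) 𝓘(ℝ, F) x p) y
        (mpullbackWithin 𝓘(ℝ, E) 𝓘(ℝ, E) (extChartAt 𝓘(ℝ, E) x).symm V univ y) =
      mpullbackWithin 𝓘(ℝ, F) 𝓘(ℝ, F) (extChartAt 𝓘(ℝ, F) (p x)).symm U univ
        (writtenInExtChartAt 𝓘(ℝ, E) 𝓘(ℝ, F) x p y) := by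
  have h1 : ∀ᶠ y in 𝓝 (extChartAt 𝓘(ℝ, E) x x), y ∈ (extChartAt 𝓘(ℝ, E) x).target :=
    extChartAt_target_mem_nhds x
  have h2 : ∀ᶠ y in 𝓝 (extChartAt 𝓘(ℝ, E) x x),
      p ((extChartAt 𝓘(ℝ, E) x).symm y) ∈ (extChartAt 𝓘(ℝ, F) (p x)).source := by
    have hc : ContinuousAt (fun y => p ((extChartAt 𝓘(ℝ, E) x).symm y))
        (extChartAt 𝓘(ℝ, E) x x) :=
      hp.continuous.continuousAt.comp (continuousAt_extChartAt_symm x)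
    apply hc
    simpa using extChartAt_source_mem_nhds (I := 𝓘(ℝ, F)) (p x)
  rw [← ModelWithCorners.range_eq_univ 𝓘(ℝ, E), ← ModelWithCorners.range_eq_univ 𝓘(ℝ, F)]
  filter_upwards [h1, h2] with y hy hpy
  set φ := extChartAt 𝓘(ℝ, E) x
  set ψ := extChartAt 𝓘(ℝ, F) (p x)
  have e1 := isInvertible_mfderivWithin_extChartAt_symm (I := 𝓘(ℝ, E)) hy
  have e2 := isInvertible_mfderivWithin_extChartAt_symm (I := 𝓘(ℝ, F)) (ψ.map_source hpy)
  have d1 := mdifferentiableWithinAt_extChartAt_symm (I := 𝓘(ℝ, E)) hy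
  have hps : p (φ.symm y) ∈ (chartAt F (p x)).source := by simpa [ψ] using hpy
  have d2 : MDifferentiableAt 𝓘(ℝ, F) 𝓘(ℝ, F) ψ (p (φ.symm y)) := mdifferentiableAt_extChartAt hps
  have d3 : MDifferentiableAt 𝓘(ℝ, E) 𝓘(ℝ, F) p (φ.symm y) := hp.mdifferentiableAt (by simp)
  have hF : fderiv ℝ (writtenInExtChartAt 𝓘(ℝ, E) 𝓘(ℝ, F) x p) y =
      (mfderiv 𝓘(ℝ, F) 𝓘(ℝ, F) ψ (p (φ.symm y))).comp
        ((mfderiv 𝓘(ℝ, E) 𝓘(ℝ, F) p (φ.symm y)).comp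
          (mfderivWithin 𝓘(ℝ, E) 𝓘(ℝ, E) φ.symm (range 𝓘(ℝ, E)) y)) := by
    simp only [modelWithCornersSelf_coe, range_id, mfderivWithin_univ] at d1 ⊢
    rw [mdifferentiableWithinAt_univ] at d1
    rw [← mfderiv_eq_fderiv]
    rw [← mfderiv_comp y d3 d1]
    exact mfderiv_comp y d2 (d3.comp y d1)
  rw [hF]
  have hi : (mfderivWithin 𝓘(ℝ, E) 𝓘(ℝ, E) φ.symm (range 𝓘(ℝ, E)) y)
      ((mfderivWithin 𝓘(ℝ, E) 𝓘(ℝ, E) φ.symm (range 𝓘(ℝ, E)) y).inverse (V (φ.symm y))) =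
        V (φ.symm y) := e1.self_apply_inverse _
  have hj : (mfderivWithin 𝓘(ℝ, F) 𝓘(ℝ, F) ψ.symm (range 𝓘(ℝ, F)) (ψ (p (φ.symm y))))
      (mfderiv 𝓘(ℝ, F) 𝓘(ℝ, F) ψ (p (φ.symm y)) (U (p (φ.symm y)))) = U (p (φ.symm y)) :=
    congrArg (fun L => L (U (p (φ.symm y))))
      (mfderivWithin_extChartAt_symm_comp_mfderiv_extChartAt' (I := 𝓘(ℝ, F)) hpy)
  change (mfderiv 𝓘(ℝ, F) 𝓘(ℝ, F) ψ (p (φ.symm y)))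
    ((mfderiv 𝓘(ℝ, E) 𝓘(ℝ, F) p (φ.symm y))
      ((mfderivWithin 𝓘(ℝ, E) 𝓘(ℝ, E) φ.symm (range 𝓘(ℝ, E)) y)
      ((mfderivWithin 𝓘(ℝ, E) 𝓘(ℝ, E) φ.symm (range 𝓘(ℝ, E)) y).inverse (V (φ.symm y))))) =
    (mfderivWithin 𝓘(ℝ, F) 𝓘(ℝ, F) ψ.symm (range 𝓘(ℝ, F)) (ψ (p (φ.symm y)))).inverse
      (U (ψ.symm (ψ (p (φ.symm y)))))
  rw [hi, hV, ψ.left_inv hpy, eq_comm]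
  exact (e2.inverse_apply_eq).2 hj.symm

theorem lieBracket_pushforward {G : E → F} {V W : E → E} {U T : F → F} {y : E}
    (hG : ContDiffAt ℝ ∞ G y) (hV : DifferentiableAt ℝ V y) (hW : DifferentiableAt ℝ W y)
    (hU : DifferentiableAt ℝ U (G y)) (hT : DifferentiableAt ℝ T (G y))
    (rV : ∀ᶠ z in 𝓝 y, fderiv ℝ G z (V z) = U (G z))
    (rW : ∀ᶠ z in 𝓝 y, fderiv ℝ G z (W z) = T (G z)) :
    fderiv ℝ G y (lieBracket ℝ V W y) = lieBracket ℝ U T (G y) := by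
  have dG : DifferentiableAt ℝ G y := hG.differentiableAt (by simp)
  have h2 : minSmoothness ℝ 2 ≤ (∞ : WithTop ℕ∞) := by
    rw [minSmoothness_of_isRCLikeNormedField]; exact WithTop.coe_le_coe.2 le_top
  rw [fderiv_apply_lieBracket hG h2 hW hV, Filter.EventuallyEq.fderiv_eq rV,
    Filter.EventuallyEq.fderiv_eq rW]
  have c1 := fderiv_comp y hT dG
  have c2 := fderiv_comp y hU dG
  simp only [Function.comp_def] at c1 c2
  rw [c1, c2]
  simp only [ContinuousLinearMap.comp_apply, lieBracket]
  rw [rV.self_of_nhds, rW.self_of_nhds]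

theorem VF.bracket_apply (V W : VF E M) (x : M) :
    V.bracket W x = lieBracket ℝ
      (mpullbackWithin 𝓘(ℝ, E) 𝓘(ℝ, E) (extChartAt 𝓘(ℝ, E) x).symm V univ)
      (mpullbackWithin 𝓘(ℝ, E) 𝓘(ℝ, E) (extChartAt 𝓘(ℝ, E) x).symm W univ)
      (extChartAt 𝓘(ℝ, E) x x) := by
  have h : ∀ L : E →L[ℝ] E, L = ContinuousLinearMap.id ℝ E → ∀ v, L.inverse v = v := by
    rintro L rfl v; simp
  refine (h _ (mfderiv_extChartAt_self (I := 𝓘(ℝ, E)) (x := x)) _).trans ?_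
  rw [ModelWithCorners.range_eq_univ, preimage_univ, univ_inter]
  exact congrFun lieBracketWithin_univ _

/-- Brackets of `p`-related vector fields are `p`-related. -/
theorem VF.mfderiv_bracket (p : M → B) (hp : ContMDiff 𝓘(ℝ, E) 𝓘(ℝ, F) ∞ p) {V W : VF E M}
    {U T : VF F B}
    (hV : ∀ x, mfderiv 𝓘(ℝ, E) 𝓘(ℝ, F) p x (V x) = U (p x))
    (hW : ∀ x, mfderiv 𝓘(ℝ, E) 𝓘(ℝ, F) p x (W x) = T (p x)) (x : M) :
    mfderiv 𝓘(ℝ, E) 𝓘(ℝ, F) p x (V.bracket W x) = U.bracket T (p x) := by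
  set G := writtenInExtChartAt 𝓘(ℝ, E) 𝓘(ℝ, F) x p with hG
  set φ := extChartAt 𝓘(ℝ, E) x with hφ
  set V' := mpullbackWithin 𝓘(ℝ, E) 𝓘(ℝ, E) φ.symm V univ with hV'
  set W' := mpullbackWithin 𝓘(ℝ, E) 𝓘(ℝ, E) φ.symm W univ with hW'
  set U' := mpullbackWithin 𝓘(ℝ, F) 𝓘(ℝ, F) (extChartAt 𝓘(ℝ, F) (p x)).symm U
    univ with hU'
  set T' := mpullbackWithin 𝓘(ℝ, F) 𝓘(ℝ, F) (extChartAt 𝓘(ℝ, F) (p x)).symm T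
    univ with hT'
  have rV := VF.related_chart p hp V U hV x
  have rW := VF.related_chart p hp W T hW x
  have hGx : G (φ x) = extChartAt 𝓘(ℝ, F) (p x) (p x) := by simp [hG, hφ, writtenInExtChartAt]
  have dV : DifferentiableAt ℝ V' (φ x) := by
    have := (V.contMDiff.mdifferentiable (by simp) x).mdifferentiableWithinAt (s := univ)
    have h2 := this.differentiableWithinAt_mpullbackWithin_vectorField
    rw [preimage_univ, univ_inter, ModelWithCorners.range_eq_univ] at h2
    exact differentiableWithinAt_univ.1 h2
  have dW : DifferentiableAt ℝ W' (φ x) := by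
    have := (W.contMDiff.mdifferentiable (by simp) x).mdifferentiableWithinAt (s := univ)
    have h2 := this.differentiableWithinAt_mpullbackWithin_vectorField
    rw [preimage_univ, univ_inter, ModelWithCorners.range_eq_univ] at h2
    exact differentiableWithinAt_univ.1 h2
  have dU : DifferentiableAt ℝ U' (G (φ x)) := by
    rw [hGx]
    have := (U.contMDiff.mdifferentiable (by simp) (p x)).mdifferentiableWithinAt (s := univ)
    have h2 := this.differentiableWithinAt_mpullbackWithin_vectorField
    rw [preimage_univ, univ_inter, ModelWithCorners.range_eq_univ] at h2
    exact differentiableWithinAt_univ.1 h2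
  have dT : DifferentiableAt ℝ T' (G (φ x)) := by
    rw [hGx]
    have := (T.contMDiff.mdifferentiable (by simp) (p x)).mdifferentiableWithinAt (s := univ)
    have h2 := this.differentiableWithinAt_mpullbackWithin_vectorField
    rw [preimage_univ, univ_inter, ModelWithCorners.range_eq_univ] at h2
    exact differentiableWithinAt_univ.1 h2
  have cG : ContDiffAt ℝ ∞ G (φ x) := by
    have := (contMDiffAt_iff.1 (hp x)).2
    rw [ModelWithCorners.range_eq_univ, contDiffWithinAt_univ] at this
    exact this
  have dG : DifferentiableAt ℝ G (φ x) := cG.differentiableAt (by simp)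
  have key := lieBracket_pushforward cG dV dW dU dT rV rW
  have e1 : V.bracket W x = lieBracket ℝ V' W' (φ x) := V.bracket_apply W x
  have e2 : U.bracket T (p x) = lieBracket ℝ U' T' (G (φ x)) := by
    rw [hGx]; exact U.bracket_apply T (p x)
  have e3 : mfderiv 𝓘(ℝ, E) 𝓘(ℝ, F) p x = fderiv ℝ G (φ x) := by
    have h := (hp.mdifferentiable (by simp) x).mfderiv
    rw [ModelWithCorners.range_eq_univ, fderivWithin_univ] at h
    exact h
  rw [e1, e2, e3]
  exact key

theorem VF.bracket_zero_right (U : VF F B) : U.bracket 0 = 0 := by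
  apply ContMDiffSection.ext
  intro x
  exact congrFun (mlieBracket_zero_right (I := 𝓘(ℝ, F)) (W := U)) x

/-- `f ↦ V f` as a linear map. -/
def VF.actL (V : VF E M) : Fn E M →ₗ[ℝ] Fn E M where
  toFun := V.act
  map_add' f g := by
    apply ContMDiffMap.ext
    intro x
    have hf := f.contMDiff.mdifferentiable (by simp) x
    have hg := g.contMDiff.mdifferentiable (by simp) x
    exact congrArg (fun L => L (V x)) (mvfderiv_add hf hg)
  map_smul' c f := by
    apply ContMDiffMap.ext
    intro x
    have hf := f.contMDiff.mdifferentiable (by simp) x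
    have h := mvfderiv_mul (mdifferentiableAt_const (c := c)) hf
    simp only [mvfderiv_const, smul_zero, add_zero] at h
    exact congrArg (fun L => L (V x)) h

variable (π : C^∞⟮𝓘(ℝ, E), M; 𝓘(ℝ, F), B⟯)

/-- `Γ(Ver)`, the vector fields tangent to the fibres of `π`. -/
def Vert : Submodule ℝ (VF E M) where
  carrier := {v | ∀ x, mfderiv 𝓘(ℝ, E) 𝓘(ℝ, F) π x (v x) = 0}
  add_mem' {v w} hv hw x := by
    rw [ContMDiffSection.coe_add, Pi.add_apply, map_add, hv x, hw x, add_zero]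
  zero_mem' x := by
    rw [ContMDiffSection.coe_zero, Pi.zero_apply, map_zero]
  smul_mem' c v hv x := by
    rw [ContMDiffSection.coe_smul, Pi.smul_apply, map_smul, hv x, smul_zero]

/-- The product of a vertical vector field by a smooth function on `M`. -/
def Vert.fmul (f : Fn E M) (v : Vert π) : Vert π :=
  ⟨VF.fmul f v.1, fun x => by
    change mfderiv 𝓘(ℝ, E) 𝓘(ℝ, F) π x (f x • v.1 x) = 0
    rw [map_smul, v.2 x, smul_zero]⟩

/-- The Lie bracket of vertical vector fields. -/
def Vert.bracket (v w : Vert π) : Vert π :=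
  ⟨v.1.bracket w.1, fun x => by
    rw [VF.mfderiv_bracket π π.contMDiff (U := 0) (T := 0) v.2 w.2, VF.bracket_zero_right]; rfl⟩

/-- The bracket `[X, w]` of a vector field `X` that projects to `u` with a vertical vector field. -/
def Vert.bracketOf (X : VF E M) (u : VF F B)
    (h : ∀ x, mfderiv 𝓘(ℝ, E) 𝓘(ℝ, F) π x (X x) = u (π x)) (w : Vert π) : Vert π :=
  ⟨X.bracket w.1, fun x => by
    rw [VF.mfderiv_bracket π π.contMDiff (T := 0) h w.2, VF.bracket_zero_right]; rfl⟩

/-! ### Forms on the base with values in vertical forms -/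

/-- Arbitrary maps from `p` vector fields on `B` and `q` vertical vector fields to `C^∞(M)`. -/
abbrev Cochain (p q : ℕ) : Type _ := (Fin p → VF F B) → (Fin q → Vert π) → Fn E M

/-- `Λ(u₁, …, u_p)(w₁, …, w_q)` is alternating and `C^∞(B)`-multilinear in the `uᵢ`, alternating
and `C^∞(M)`-multilinear in the `wⱼ`. -/
structure IsForm {p q : ℕ} (Λ : Cochain π p q) : Prop where
  base_add : ∀ u w i a b, Λ (Function.update u i (a + b)) w =
    Λ (Function.update u i a) w + Λ (Function.update u i b) w
  base_fmul : ∀ u w i (f : Fn F B) a, Λ (Function.update u i (VF.fmul f a)) w =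
    f.comp π * Λ (Function.update u i a) w
  base_alt : ∀ u w i j, i ≠ j → u i = u j → Λ u w = 0
  vert_add : ∀ u w i a b, Λ u (Function.update w i (a + b)) =
    Λ u (Function.update w i a) + Λ u (Function.update w i b)
  vert_fmul : ∀ u w i (f : Fn E M) a, Λ u (Function.update w i (Vert.fmul π f a)) =
    f * Λ u (Function.update w i a)
  vert_alt : ∀ u w i j, i ≠ j → w i = w j → Λ u w = 0

/-- `Ω^p(B, Ω^q(Ver))`. For `p = 0` this is `Ω^q(Ver)`, for `q = 0` it is `Ω^p(B, C^∞(M))`. -/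
def Form (p q : ℕ) : Submodule ℝ (Cochain π p q) where
  carrier := {Λ | IsForm π Λ}
  add_mem' {Λ Λ'} h h' :=
    { base_add := fun u w i a b => by
        simp only [Pi.add_apply, h.base_add, h'.base_add]; abel
      base_fmul := fun u w i f a => by
        simp only [Pi.add_apply, h.base_fmul, h'.base_fmul, mul_add]
      base_alt := fun u w i j hij e => by
        simp only [Pi.add_apply, h.base_alt u w i j hij e, h'.base_alt u w i j hij e, add_zero]
      vert_add := fun u w i a b => by
        simp only [Pi.add_apply, h.vert_add, h'.vert_add]; abel
      vert_fmul := fun u w i f a => by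
        simp only [Pi.add_apply, h.vert_fmul, h'.vert_fmul, mul_add]
      vert_alt := fun u w i j hij e => by
        simp only [Pi.add_apply, h.vert_alt u w i j hij e, h'.vert_alt u w i j hij e, add_zero] }
  zero_mem' :=
    { base_add := fun u w i a b => by simp
      base_fmul := fun u w i f a => by simp
      base_alt := fun u w i j hij e => rfl
      vert_add := fun u w i a b => by simp
      vert_fmul := fun u w i f a => by simp
      vert_alt := fun u w i j hij e => rfl }
  smul_mem' c Λ h :=
    { base_add := fun u w i a b => by
        simp only [Pi.smul_apply, h.base_add, smul_add]
      base_fmul := fun u w i f a => by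
        simp only [Pi.smul_apply, h.base_fmul, mul_smul_comm]
      base_alt := fun u w i j hij e => by
        simp only [Pi.smul_apply, h.base_alt u w i j hij e, smul_zero]
      vert_add := fun u w i a b => by
        simp only [Pi.smul_apply, h.vert_add, smul_add]
      vert_fmul := fun u w i f a => by
        simp only [Pi.smul_apply, h.vert_fmul, mul_smul_comm]
      vert_alt := fun u w i j hij e => by
        simp only [Pi.smul_apply, h.vert_alt u w i j hij e, smul_zero] }

/-- The Koszul formula
`∑ᵢ (-1)ⁱ vᵢ · Λ(v₀, …, v̂ᵢ, …) + ∑_{i<j} (-1)^{i+j} Λ([vᵢ, vⱼ], v₀, …, v̂ᵢ, …, v̂ⱼ, …)`.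
In the second sum the bracket is written in the `i`-th slot instead of the first one, which
changes the sign of the term by `(-1)ⁱ` when `Λ` is alternating and leaves `(-1)ʲ`. -/
def koszul {L N : Type*} [AddCommGroup N] [Module ℝ N] (act : L → N →ₗ[ℝ] N) (br : L → L → L)
    (n : ℕ) : ((Fin n → L) → N) →ₗ[ℝ] ((Fin (n + 1) → L) → N) where
  toFun Λ v := (∑ i : Fin (n + 1), (-1 : ℝ) ^ (i : ℕ) • act (v i) (Λ fun k => v (i.succAbove k))) +
    ∑ i : Fin (n + 1), ∑ j : Fin (n + 1), if i < j then
      (-1 : ℝ) ^ (j : ℕ) • Λ (fun k => Function.update v i (br (v i) (v j)) (j.succAbove k)) else 0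
  map_add' Λ Λ' := by
    funext v
    simp only [Pi.add_apply, map_add, smul_add, Finset.sum_add_distrib, ite_add_zero]
    abel
  map_smul' c Λ := by
    funext v
    simp only [Pi.smul_apply, map_smul, smul_add, Finset.smul_sum, RingHom.id_apply, smul_ite,
      smul_zero, smul_comm c]

/-- The vertical differential `d_V = δ_{0,1}` on `Ω^p(B, Ω^q(Ver))`: the fibrewise de Rham
differential of the values, times `(-1)^p`. -/
def dVer (p q : ℕ) : Cochain π p q →ₗ[ℝ] Cochain π p (q + 1) where
  toFun Λ u := (-1 : ℝ) ^ p • koszul (fun v : Vert π => v.1.actL) (Vert.bracket π) q (Λ u)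
  map_add' Λ Λ' := by
    funext u
    simp only [Pi.add_apply, map_add, smul_add]
  map_smul' c Λ := by
    funext u
    simp only [Pi.smul_apply, map_smul, RingHom.id_apply, smul_comm c]

/-- The range of `d_V` in `Ω^p(B, Ω^q(Ver))`. -/
def exactForm (p : ℕ) : (q : ℕ) → Submodule ℝ (Cochain π p q)
  | 0 => ⊥
  | q + 1 => (Form π p q).map (dVer π p q)

/-- The kernel of `d_V` in `Ω^p(B, Ω^q(Ver))`. -/
def closedForm (p q : ℕ) : Submodule ℝ (Cochain π p q) :=
  Form π p q ⊓ LinearMap.ker (dVer π p q)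

/-- `E_1^{p,q} = Ω^p(B, H^q(Ver))`, the cohomology of `d_V` on `Ω^p(B, Ω^•(Ver))`. -/
abbrev E1 (p q : ℕ) : Type _ :=
  (closedForm π p q) ⧸ (exactForm π p q).comap (closedForm π p q).subtype

/-- The class `[Λ]_1`. -/
abbrev E1.mk (p q : ℕ) : closedForm π p q →ₗ[ℝ] E1 π p q :=
  ((exactForm π p q).comap (closedForm π p q).subtype).mkQ

/-! ### Ehresmann connections -/

/-- An Ehresmann connection: a smooth subbundle `Hor` of `TM` complementary to `Ver = ker dπ`.
Smoothness of `Hor` is expressed by smoothness of the horizontal lifts of vector fields. -/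
structure Connection where
  /-- The horizontal subspaces. -/
  hor : ∀ x : M, Submodule ℝ (TangentSpace 𝓘(ℝ, E) x)
  isCompl : ∀ x, IsCompl (LinearMap.ker (mfderiv 𝓘(ℝ, E) 𝓘(ℝ, F) π x).toLinearMap) (hor x)
  exists_lift : ∀ u : VF F B, ∃ v : VF E M, ∀ x,
    v x ∈ hor x ∧ mfderiv 𝓘(ℝ, E) 𝓘(ℝ, F) π x (v x) = u (π x)

namespace Connection

variable {π} (h : Connection π)

/-- The horizontal lift `h(u)`, the only section of `Hor` that projects to `u`. -/
def lift (u : VF F B) : VF E M := (h.exists_lift u).choose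

theorem lift_mem (u : VF F B) (x : M) : h.lift u x ∈ h.hor x :=
  ((h.exists_lift u).choose_spec x).1

theorem mfderiv_lift (u : VF F B) (x : M) :
    mfderiv 𝓘(ℝ, E) 𝓘(ℝ, F) π x (h.lift u x) = u (π x) :=
  ((h.exists_lift u).choose_spec x).2

/-- Every smooth curve in `B` has a horizontal lift, defined for all times, through every point
over its value at `0`. -/
def IsComplete : Prop :=
  ∀ c : ℝ → B, ContMDiff 𝓘(ℝ, ℝ) 𝓘(ℝ, F) ∞ c → ∀ x : M, π x = c 0 →
    ∃ γ : ℝ → M, ContMDiff 𝓘(ℝ, ℝ) 𝓘(ℝ, E) ∞ γ ∧ γ 0 = x ∧ (∀ t, π (γ t) = c t) ∧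
      ∀ t, mfderiv 𝓘(ℝ, ℝ) 𝓘(ℝ, E) γ t (1 : ℝ) ∈ h.hor (γ t)

/-- The curvature `C(u, v) = [h(u), h(v)] - h([u, v])`. -/
def curvature (u v : VF F B) : Vert π :=
  ⟨(h.lift u).bracket (h.lift v) - h.lift (u.bracket v), fun x => by
    rw [ContMDiffSection.coe_sub, Pi.sub_apply, map_sub, h.mfderiv_lift,
      VF.mfderiv_bracket π π.contMDiff (h.mfderiv_lift u) (h.mfderiv_lift v), sub_self]⟩

/-- The Lie derivative of vertical `q`-forms along `h(u)`:
`(L_{h(u)} η)(w₁, …, w_q) = h(u) · η(w₁, …, w_q) - ∑ₖ η(w₁, …, [h(u), wₖ], …, w_q)`. -/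
def lieDeriv (q : ℕ) (u : VF F B) :
    ((Fin q → Vert π) → Fn E M) →ₗ[ℝ] ((Fin q → Vert π) → Fn E M) where
  toFun η w := (h.lift u).actL (η w) - ∑ k,
    η (Function.update w k (Vert.bracketOf π (h.lift u) u (h.mfderiv_lift u) (w k)))
  map_add' η η' := by
    funext w
    simp only [Pi.add_apply, map_add, Finset.sum_add_distrib]
    abel
  map_smul' c η := by
    funext w
    simp only [Pi.smul_apply, map_smul, ← Finset.smul_sum, smul_sub, RingHom.id_apply]

/-- The covariant derivative `d_H = δ_{1,0}` on `Ω^p(B, Ω^q(Ver))`. -/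
def dHor (p q : ℕ) : Cochain π p q →ₗ[ℝ] Cochain π (p + 1) q :=
  koszul (h.lieDeriv q) VF.bracket p

/-- The contraction with the curvature `d_C = δ_{2,-1}` on `Ω^p(B, Ω^{q+1}(Ver))`:
`(d_C Λ)(v₀, …, v_{p+1}) = (-1)^p ∑_{i<j} (-1)^{i+j} i_{C(vᵢ, vⱼ)} Λ(v₀, …, v̂ᵢ, …, v̂ⱼ, …, v_{p+1})`.
-/
def dCurv (p q : ℕ) (Λ : Cochain π p (q + 1)) : Cochain π (p + 2) q := fun v w =>
  (-1 : ℝ) ^ p • ∑ i : Fin (p + 1), ∑ j : Fin (p + 2), if i.castSucc < j then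
    (-1 : ℝ) ^ ((i : ℕ) + (j : ℕ)) • Λ (fun k => v (j.succAbove (i.succAbove k)))
      (Fin.cons (h.curvature (v i.castSucc) (v j)) w) else 0

/-- The kernel in `E_1^{p,q}` of the differential `[Λ]_1 ↦ [d_H Λ]_1`. -/
def Z2 (p q : ℕ) : Submodule ℝ (E1 π p q) :=
  (((exactForm π (p + 1) q).comap (h.dHor p q)).comap (closedForm π p q).subtype).map
    (E1.mk π p q)

/-- The range in `E_1^{p,q}` of the differential `[Λ]_1 ↦ [d_H Λ]_1`. -/
def B2 : (p q : ℕ) → Submodule ℝ (E1 π p q)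
  | 0, _ => ⊥
  | p + 1, q => (((closedForm π p q).map (h.dHor p q)).comap
      (closedForm π (p + 1) q).subtype).map (E1.mk π (p + 1) q)

/-- `E_2^{p,q} = H^p(B, H^q(Ver))`, the cohomology of `E_1^{•,q}`. -/
abbrev E2 (p q : ℕ) : Type _ := h.Z2 p q ⧸ (h.B2 p q).comap (h.Z2 p q).subtype

/-- `Λ ∈ Ω^p(B, Ω^q(Ver))` is `d_V`-closed, `[Λ]_1` is a cocycle of `E_1`, and `[Λ]_2 = c`. -/
def HasClass {p q : ℕ} (Λ : Cochain π p q) (c : h.E2 p q) : Prop :=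
  ∃ (hΛ : Λ ∈ closedForm π p q) (hz : E1.mk π p q ⟨Λ, hΛ⟩ ∈ h.Z2 p q),
    c = ((h.B2 p q).comap (h.Z2 p q).subtype).mkQ ⟨E1.mk π p q ⟨Λ, hΛ⟩, hz⟩

/-- A symplectic connection: `d_H σ = 0`, that is, `L_{h(u)} σ = 0` for all `u`. -/
def IsSymplectic (σ : Cochain π 0 2) : Prop := h.dHor 0 2 σ = 0

/-- The curvature is hamiltonian: `d_C σ + d_V σ_H = 0` for some `σ_H ∈ Ω²(B, C^∞(M))`, that is,
`i_{C(u, v)} σ` is the vertical differential of `σ_H(u, v)`. -/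
def HasHamiltonianCurvature (σ : Cochain π 0 2) : Prop :=
  ∃ σH ∈ Form π 2 0, h.dCurv 0 1 σ + dVer π 2 0 σH = 0

end Connection

/-- `σ` restricts to a nondegenerate form on `Ver_x` for every `x`. -/
def IsNondegenerate (σ : Cochain π 0 2) : Prop :=
  ∀ (x : M) (v : Vert π), (∀ w : Vert π, σ ![] ![v, w] x = 0) → v.1 x = 0

/-- `(π : M → B, σ)` is a symplectic fibration: `π` is a submersion and `σ ∈ Ω²(Ver)` is vertically
closed, nondegenerate and preserved by some complete Ehresmann connection. -/
structure IsSymplecticFibration (σ : Cochain π 0 2) : Prop where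
  isSubmersion : Manifold.IsSubmersion 𝓘(ℝ, E) 𝓘(ℝ, F) ∞ π
  mem_form : σ ∈ Form π 0 2
  closed : dVer π 0 2 σ = 0
  nondegenerate : IsNondegenerate π σ
  exists_symplectic : ∃ h : Connection π, h.IsComplete ∧ h.IsSymplectic σ

end

end SympFib

end

open scoped Manifold ContDiff
open SympFib

/-!
All objects are global sections, and the proof is a computation with them.

*Independence of the connection.* For two connections `h`, `h'` put `A(u) = h'(u) - h(u)`, a
vertical field depending `C^∞(B)`-linearly on `u` (`Connection.diff`). If the values of `Λ` are
closed vertical one-forms, Cartan's formula `L_X = d i_X + i_X d` shows that `d_{H'} Λ - d_H Λ` is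
`d_V` of the form obtained by inserting `A(vᵢ)` into `Λ` (`dHor_one_sub_mem_exactForm`,
`dHor_two_sub_mem_exactForm`). Hence the differential of `E_1^{•,1}` in these degrees does not
depend on the connection.

*The class.* If `h` is symplectic, then `L_{C(u,v)} σ = 0`, so `d_C σ` is `d_V`-closed by Cartan's
formula, and `d_H d_C σ = 0` by the Bianchi identity. A second connection is symplectic if and only
if the one-forms `α(u) = i_{A(u)} σ` are closed, and then
`d_{C'} σ = d_C σ - d_H α + d_V ψ` with `ψ(u, v) = σ(A(u), A(v))` (`IsSymplectic.dCurv_eq`). So the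
classes in `E_2` agree.

*Vanishing.* If `d_C σ = d_H α + d_V ψ'` with `α` closed, nondegeneracy of `σ` gives vertical fields
`A(u)` with `i_{A(u)} σ = α(u)`, and `h + A` is a symplectic connection with hamiltonian curvature by
the same formula.

The analytic input is in two places. Cut off coordinate fields (`VF.exists_frame`) show that
`C^∞`-linear maps on vector fields are pointwise, first on `M` and `B` and then, through the vertical
projection of a connection, on vertical fields (`Connection.vert_map_eq_sum`). This makes `h + A` a
connection. The equation `i_A σ = θ` is solved locally by inverting the Gram matrix of a vertical
frame, and the local solutions agree by nondegeneracy (`IsForm.exists_pair_eq`).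
-/

noncomputable section

set_option linter.unusedSectionVars false

open scoped Manifold ContDiff Topology
open VectorField Set

namespace SympFib

section

variable {E : Type*} [NormedAddCommGroup E] [NormedSpace ℝ E] [FiniteDimensional ℝ E]
  {F : Type*} [NormedAddCommGroup F] [NormedSpace ℝ F] [FiniteDimensional ℝ F]
  {M : Type*} [TopologicalSpace M] [ChartedSpace E M] [IsManifold 𝓘(ℝ, E) ∞ M]
  {B : Type*} [TopologicalSpace B] [ChartedSpace F B] [IsManifold 𝓘(ℝ, F) ∞ B]

/-! ### The Lie algebra of vector fields and its action on functions -/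

theorem VF.ext {V W : VF E M} (h : ∀ x, V x = W x) : V = W := ContMDiffSection.ext h

theorem VF.fmul_apply (f : Fn E M) (V : VF E M) (x : M) : VF.fmul f V x = f x • V x := rfl

theorem VF.add_apply (V W : VF E M) (x : M) : (V + W) x = V x + W x := rfl

theorem VF.sub_apply (V W : VF E M) (x : M) : (V - W) x = V x - W x := rfl

theorem VF.sum_apply {ι : Type*} (s : Finset ι) (V : ι → VF E M) (x : M) :
    (∑ i ∈ s, V i) x = ∑ i ∈ s, V i x :=
  map_sum (⟨⟨fun V : VF E M => V x, rfl⟩, fun _ _ => rfl⟩ : VF E M →+ TangentSpace 𝓘(ℝ, E) x) _ _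

theorem Fn.ext {f g : Fn E M} (h : ∀ x, f x = g x) : f = g := ContMDiffMap.ext h

theorem Fn.mdifferentiableAt (f : Fn E M) (x : M) : MDifferentiableAt 𝓘(ℝ, E) 𝓘(ℝ, ℝ) f x :=
  f.contMDiff.mdifferentiable (by simp) x

theorem VF.mdifferentiableAt (V : VF E M) (x : M) :
    MDifferentiableAt 𝓘(ℝ, E) (𝓘(ℝ, E).prod 𝓘(ℝ, E))
      (fun y => (V y : TangentBundle 𝓘(ℝ, E) M)) x :=
  V.contMDiff.mdifferentiable (by simp) x

theorem VF.act_apply (V : VF E M) (f : Fn E M) (x : M) :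
    V.act f x = mvfderiv 𝓘(ℝ, E) f x (V x) := rfl

theorem VF.act_add (V : VF E M) (f g : Fn E M) : V.act (f + g) = V.act f + V.act g :=
  V.actL.map_add f g

theorem VF.act_sub (V : VF E M) (f g : Fn E M) : V.act (f - g) = V.act f - V.act g :=
  V.actL.map_sub f g

theorem VF.act_neg (V : VF E M) (f : Fn E M) : V.act (-f) = -V.act f :=
  V.actL.map_neg f

theorem VF.act_zero (V : VF E M) : V.act 0 = 0 :=
  V.actL.map_zero

theorem VF.act_mul (V : VF E M) (f g : Fn E M) : V.act (f * g) = V.act f * g + f * V.act g := by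
  apply Fn.ext
  intro x
  have h := mvfderiv_mul (f.mdifferentiableAt x) (g.mdifferentiableAt x)
  refine (congrArg (fun L => L (V x)) h).trans ?_
  change f x * mvfderiv 𝓘(ℝ, E) g x (V x) + g x * mvfderiv 𝓘(ℝ, E) f x (V x) =
    mvfderiv 𝓘(ℝ, E) f x (V x) * g x + f x * mvfderiv 𝓘(ℝ, E) g x (V x)
  ring

theorem VF.add_act (V W : VF E M) (f : Fn E M) : (V + W).act f = V.act f + W.act f :=
  Fn.ext fun x => map_add (mvfderiv 𝓘(ℝ, E) f x) (V x) (W x)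

theorem VF.sub_act (V W : VF E M) (f : Fn E M) : (V - W).act f = V.act f - W.act f :=
  Fn.ext fun x => map_sub (mvfderiv 𝓘(ℝ, E) f x) (V x) (W x)

theorem VF.fmul_act (g : Fn E M) (V : VF E M) (f : Fn E M) :
    (VF.fmul g V).act f = g * V.act f :=
  Fn.ext fun x => map_smul (mvfderiv 𝓘(ℝ, E) f x) (g x) (V x)

theorem VF.act_eq_zero_of_apply_eq_zero {V : VF E M} {x : M} (h : V x = 0) (f : Fn E M) :
    V.act f x = 0 := by
  rw [VF.act_apply, h, map_zero]

theorem VF.bracket_swap (V W : VF E M) : V.bracket W = -W.bracket V :=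
  VF.ext fun x => mlieBracket_swap_apply (I := 𝓘(ℝ, E)) (V := V) (W := W) (x := x)

theorem VF.bracket_self (V : VF E M) : V.bracket V = 0 :=
  VF.ext fun x => congrFun (mlieBracket_self (I := 𝓘(ℝ, E)) (V := V)) x

theorem VF.bracket_add_right (V W W' : VF E M) :
    V.bracket (W + W') = V.bracket W + V.bracket W' :=
  VF.ext fun x => mlieBracket_add_right (I := 𝓘(ℝ, E)) (V := V) (W.mdifferentiableAt x)
    (W'.mdifferentiableAt x)

theorem VF.bracket_add_left (V V' W : VF E M) :
    (V + V').bracket W = V.bracket W + V'.bracket W :=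
  VF.ext fun x => mlieBracket_add_left (I := 𝓘(ℝ, E)) (W := W) (V.mdifferentiableAt x)
    (V'.mdifferentiableAt x)

theorem VF.bracket_fmul_right (V : VF E M) (f : Fn E M) (W : VF E M) :
    V.bracket (VF.fmul f W) = VF.fmul (V.act f) W + VF.fmul f (V.bracket W) :=
  VF.ext fun x => mlieBracket_smul_right (I := 𝓘(ℝ, E)) (V := V) (f.mdifferentiableAt x)
    (W.mdifferentiableAt x)

theorem VF.bracket_neg_right (V W : VF E M) : V.bracket (-W) = -V.bracket W := by
  have h := V.bracket_add_right W (-W)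
  rw [add_neg_cancel, VF.bracket_zero_right] at h
  exact (neg_eq_of_add_eq_zero_right h.symm).symm

theorem VF.bracket_sub_right (V W W' : VF E M) :
    V.bracket (W - W') = V.bracket W - V.bracket W' := by
  rw [sub_eq_add_neg, VF.bracket_add_right, VF.bracket_neg_right, ← sub_eq_add_neg]

theorem VF.bracket_sub_left (V V' W : VF E M) :
    (V - V').bracket W = V.bracket W - V'.bracket W := by
  rw [VF.bracket_swap, VF.bracket_sub_right, VF.bracket_swap W V, VF.bracket_swap W V']
  abel

/-- The Jacobi identity. -/
theorem VF.bracket_bracket (U V W : VF E M) :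
    U.bracket (V.bracket W) = (U.bracket V).bracket W + V.bracket (U.bracket W) := by
  have : IsManifold 𝓘(ℝ, E) ((∞ : WithTop ℕ∞) + 1) M := by
    simpa using (inferInstance : IsManifold 𝓘(ℝ, E) ∞ M)
  have h2 : minSmoothness ℝ 2 ≤ (∞ : WithTop ℕ∞) := by
    rw [minSmoothness_of_isRCLikeNormedField]; exact WithTop.coe_le_coe.2 le_top
  have : IsManifold 𝓘(ℝ, E) (minSmoothness ℝ 3) M := by
    rw [minSmoothness_of_isRCLikeNormedField]
    exact IsManifold.of_le (n := ∞) (WithTop.coe_le_coe.2 le_top)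
  exact VF.ext fun x => leibniz_identity_mlieBracket_apply (I := 𝓘(ℝ, E))
    ((U.contMDiff x).of_le h2) ((V.contMDiff x).of_le h2) ((W.contMDiff x).of_le h2)

/-- The bracket is the commutator of derivations. It follows from the Jacobi identity for
`V`, `W`, `f X`, whose terms without derivatives of `X` say that both sides agree after
multiplication by an arbitrary vector field `X`. -/
theorem VF.bracket_act (V W : VF E M) (f : Fn E M) :
    (V.bracket W).act f = V.act (W.act f) - W.act (V.act f) := by
  have aux : ∀ {N : Type _} [AddCommGroup N] [Module ℝ N] {a b c p q r : ℝ} {X Y Z T S : N},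
      a • X + b • Y + (c • Z + p • (T + S)) = q • X + p • T + (r • X + c • Z + (b • Y + p • S)) →
        (q - (a - r)) • X = 0 := by
    intro N _ _ a b c p q r X Y Z T S h
    linear_combination (norm := module) (-1 : ℝ) • h
  have key : ∀ X : VF E M,
      VF.fmul ((V.bracket W).act f - (V.act (W.act f) - W.act (V.act f))) X = 0 := by
    intro X
    have h1 := VF.bracket_bracket V W (VF.fmul f X)
    have h2 := VF.bracket_bracket V W X
    simp only [VF.bracket_fmul_right, VF.bracket_add_right, h2] at h1
    apply VF.ext
    intro x
    have h3 := congrArg (fun Y : VF E M => Y x) h1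
    simp only [VF.add_apply, VF.fmul_apply] at h3
    change ((V.bracket W).act f x - (V.act (W.act f) x - W.act (V.act f) x)) • X x = 0
    exact aux h3
  apply Fn.ext
  intro x
  by_contra hne
  have h0 : ∀ X : VF E M, X x = 0 := fun X =>
    (smul_eq_zero.1 (congrArg (fun Y : VF E M => Y x) (key X))).resolve_left (sub_ne_zero.2 hne)
  apply hne
  change _ = V.act (W.act f) x - W.act (V.act f) x
  rw [VF.act_eq_zero_of_apply_eq_zero (h0 _), VF.act_eq_zero_of_apply_eq_zero (h0 _),
    VF.act_eq_zero_of_apply_eq_zero (h0 _), sub_zero]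

/-! ### Coordinate vector fields cut off by bump functions -/

/-- Around every point there are a cutoff function `g`, coordinate functions `Y i` and cut off
coordinate vector fields `e i`, all defined globally, such that `g X = ∑ i, X(Y i) e i` for every
vector field `X`; the `e i` span the tangent space at the point. -/
theorem VF.exists_frame [T2Space M] (x₀ : M) :
    ∃ (g : Fn E M) (Y : Fin (Module.finrank ℝ E) → Fn E M)
      (e : Fin (Module.finrank ℝ E) → VF E M), (∀ᶠ x in 𝓝 x₀, g x = 1) ∧
      (∀ v : TangentSpace 𝓘(ℝ, E) x₀, ∃ c : Fin (Module.finrank ℝ E) → ℝ,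
        ∑ i, c i • e i x₀ = v) ∧
      ∀ X : VF E M, VF.fmul g X = ∑ i, VF.fmul (X.act (Y i)) (e i) := by
  classical
  have : IsManifold 𝓘(ℝ, E) ((∞ : WithTop ℕ∞) + 1) M := by
    simpa using (inferInstance : IsManifold 𝓘(ℝ, E) ∞ M)
  let b := Module.finBasis ℝ E
  let T := trivializationAt E (TangentSpace 𝓘(ℝ, E) : M → Type _) x₀
  let f : SmoothBumpFunction 𝓘(ℝ, E) x₀ := Classical.arbitrary _
  have hT : T.baseSet = (chartAt E x₀).source := TangentBundle.trivializationAt_baseSet x₀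
  -- the cutoff `g` is supported where `f = 1`, so that `Y i` is a coordinate there
  obtain ⟨U, hU1, hUo, hxU⟩ := mem_nhds_iff.1 (Filter.inter_mem f.eventuallyEq_one
    ((chartAt E x₀).open_source.mem_nhds (mem_chart_source E x₀)))
  obtain ⟨g, -, hg⟩ := (SmoothBumpFunction.nhds_basis_tsupport (I := 𝓘(ℝ, E)) x₀).mem_iff.1
    (hUo.mem_nhds hxU)
  have hφ : ∀ i, ContMDiffOn 𝓘(ℝ, E) 𝓘(ℝ, ℝ) ∞ (fun x => b.coord i (extChartAt 𝓘(ℝ, E) x₀ x))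
      (chartAt E x₀).source := fun i =>
    ((b.coord i).toContinuousLinearMap.contMDiff).comp_contMDiffOn contMDiffOn_extChartAt
  let Y : Fin (Module.finrank ℝ E) → Fn E M := fun i =>
    ⟨fun x => f x • b.coord i (extChartAt 𝓘(ℝ, E) x₀ x), f.contMDiff_smul (hφ i)⟩
  let e : Fin (Module.finrank ℝ E) → VF E M := fun i =>
    ⟨fun x => g x • T.localFrame b i x, ContMDiffOn.smul_section_of_tsupport
      (g.contMDiff.contMDiffOn (s := U)) hUo hg
      ((T.contMDiffOn_localFrame_baseSet (I := 𝓘(ℝ, E)) ∞ b i).mono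
        (hT ▸ fun x hx => (hU1 hx).2))⟩
  refine ⟨⟨g, g.contMDiff⟩, Y, e, g.eventuallyEq_one, fun v => ?_, fun X => VF.ext fun x => ?_⟩
  · have hx : x₀ ∈ T.baseSet := hT ▸ mem_chart_source E x₀
    refine ⟨fun i => (T.basisAt b hx).repr v i, ?_⟩
    have h1 : ∀ i, e i x₀ = T.basisAt b hx i := by
      intro i
      change g x₀ • T.localFrame b i x₀ = _
      rw [g.eq_one, one_smul, T.localFrame_apply_of_mem_baseSet b hx]
    rw [Finset.sum_congr rfl fun i _ => by rw [h1 i]]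
    exact (T.basisAt b hx).sum_repr v
  rw [VF.sum_apply]
  change g x • X x = ∑ i, mvfderiv 𝓘(ℝ, E) (Y i) x (X x) • g x • T.localFrame b i x
  by_cases hgx : g x = 0
  · simp [hgx]
  have hxU' : x ∈ U := hg (subset_tsupport _ hgx)
  have hxs : x ∈ (chartAt E x₀).source := (hU1 hxU').2
  have hxT : x ∈ T.baseSet := hT ▸ hxs
  have hY : ∀ i, mvfderiv 𝓘(ℝ, E) (Y i) x (X x) =
      T.localFrameCoeff 𝓘(ℝ, E) b i x (X x) := by
    intro i
    have h1 : (Y i : M → ℝ) =ᶠ[𝓝 x] (b.coord i) ∘ (extChartAt 𝓘(ℝ, E) x₀) := by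
      filter_upwards [hUo.mem_nhds hxU'] with y hy
      have : f y = 1 := (hU1 hy).1
      change f y • b.coord i (extChartAt 𝓘(ℝ, E) x₀ y) = _
      rw [this, one_smul]; rfl
    have h2 : MDifferentiableAt 𝓘(ℝ, E) 𝓘(ℝ, E) (extChartAt 𝓘(ℝ, E) x₀) x :=
      mdifferentiableAt_extChartAt hxs
    have h3 : MDifferentiableAt 𝓘(ℝ, E) 𝓘(ℝ, ℝ) (b.coord i) (extChartAt 𝓘(ℝ, E) x₀ x) :=
      (b.coord i).toContinuousLinearMap.contMDiff.mdifferentiable one_ne_zero _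
    have h4 : mvfderiv 𝓘(ℝ, E) (Y i) x (X x) = mvfderiv 𝓘(ℝ, E)
        ((b.coord i) ∘ (extChartAt 𝓘(ℝ, E) x₀)) x (X x) :=
      congrArg (fun L : E →L[ℝ] ℝ => L (X x)) h1.mfderiv_eq
    have h5 : mvfderiv 𝓘(ℝ, E) (b.coord i) (extChartAt 𝓘(ℝ, E) x₀ x) =
        (b.coord i).toContinuousLinearMap := by
      refine (mfderiv_eq_fderiv (f := b.coord i)).trans ?_
      exact (b.coord i).toContinuousLinearMap.fderiv
    rw [T.localFrameCoeff_eq_coeff (b := b) hxT (s := X), h4, mvfderiv_comp_apply x h3 h2, h5,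
      ← TangentBundle.continuousLinearMapAt_trivializationAt hxs]
    change b.repr (T.continuousLinearMapAt ℝ x (X x)) i = _
    rw [Bundle.Trivialization.continuousLinearMapAt_apply,
      Bundle.Trivialization.linearMapAt_apply, if_pos hxT]
  rw [Finset.sum_congr rfl fun i _ => by rw [hY i, smul_comm], ← Finset.smul_sum,
    ← T.eq_sum_localFrameCoeff_smul (I := 𝓘(ℝ, E)) (b := b) (s := X) hxT]

theorem VF.exists_apply_eq [T2Space M] (x : M) (v : TangentSpace 𝓘(ℝ, E) x) :
    ∃ X : VF E M, X x = v := by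
  obtain ⟨g, Y, e, -, he, -⟩ := VF.exists_frame (E := E) x
  obtain ⟨c, hc⟩ := he v
  refine ⟨∑ i, VF.fmul (algebraMap ℝ (Fn E M) (c i)) (e i), ?_⟩
  rw [VF.sum_apply]
  exact hc

/-- Tensoriality: an additive map on vector fields that is linear over functions, evaluated at a
point `x`, kills the vector fields that vanish at `x`. -/
theorem VF.map_eq_zero_of_apply_eq_zero [T2Space M] {V : Type*} [AddCommGroup V] [Module ℝ V]
    (x : M) (A : VF E M →+ V) (hA : ∀ f X, A (VF.fmul f X) = f x • A X) {X : VF E M}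
    (hX : X x = 0) : A X = 0 := by
  obtain ⟨g, Y, e, hg, -, he⟩ := VF.exists_frame (E := E) x
  have h := congrArg A (he X)
  rw [hA, hg.self_of_nhds, one_smul, map_sum] at h
  rw [h]
  refine Finset.sum_eq_zero fun i _ => ?_
  rw [hA, VF.act_eq_zero_of_apply_eq_zero hX, zero_smul]

/-! ### Connections, vertical fields and tensoriality -/

variable {π : C^∞⟮𝓘(ℝ, E), M; 𝓘(ℝ, F), B⟯}

theorem Vert.ext {v w : Vert π} (h : ∀ x, v.1 x = w.1 x) : v = w := Subtype.ext (VF.ext h)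

theorem Vert.sum_apply {ι : Type*} (s : Finset ι) (w : ι → Vert π) (x : M) :
    (∑ i ∈ s, w i).1 x = ∑ i ∈ s, (w i).1 x := by
  rw [AddSubmonoidClass.coe_finsetSum, VF.sum_apply]

namespace Connection

variable (h : Connection π)

/-- A horizontal vector field is determined by its projection. -/
theorem eq_of_mem_of_mfderiv_eq {x : M} {v w : TangentSpace 𝓘(ℝ, E) x} (hv : v ∈ h.hor x)
    (hw : w ∈ h.hor x)
    (e : mfderiv 𝓘(ℝ, E) 𝓘(ℝ, F) π x v = mfderiv 𝓘(ℝ, E) 𝓘(ℝ, F) π x w) : v = w := by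
  have h1 : v - w ∈ LinearMap.ker (mfderiv 𝓘(ℝ, E) 𝓘(ℝ, F) π x).toLinearMap := by
    change mfderiv 𝓘(ℝ, E) 𝓘(ℝ, F) π x (v - w) = 0
    rw [map_sub, e, sub_self]
  exact sub_eq_zero.1 ((Submodule.disjoint_def.1 (h.isCompl x).disjoint) _ h1
    ((h.hor x).sub_mem hv hw))

theorem lift_eq_of_mem {u : VF F B} {X : VF E M} (hX : ∀ x, X x ∈ h.hor x)
    (hu : ∀ x, mfderiv 𝓘(ℝ, E) 𝓘(ℝ, F) π x (X x) = u (π x)) : h.lift u = X :=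
  VF.ext fun x => h.eq_of_mem_of_mfderiv_eq (h.lift_mem u x) (hX x)
    ((h.mfderiv_lift u x).trans (hu x).symm)

theorem lift_add (u v : VF F B) : h.lift (u + v) = h.lift u + h.lift v :=
  h.lift_eq_of_mem (fun x => (h.hor x).add_mem (h.lift_mem u x) (h.lift_mem v x)) fun x => by
    rw [VF.add_apply, map_add, h.mfderiv_lift, h.mfderiv_lift]; rfl

theorem lift_fmul (f : Fn F B) (u : VF F B) :
    h.lift (VF.fmul f u) = VF.fmul (f.comp π) (h.lift u) :=
  h.lift_eq_of_mem (fun x => (h.hor x).smul_mem _ (h.lift_mem u x)) fun x => by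
    rw [VF.fmul_apply, map_smul, h.mfderiv_lift]; rfl

/-- For `X` projecting to `u`, the derivative along `X` of a function pulled back from the base. -/
theorem _root_.SympFib.VF.act_comp_apply (X : VF E M) (u : VF F B) (f : Fn F B) {x : M}
    (hu : mfderiv 𝓘(ℝ, E) 𝓘(ℝ, F) π x (X x) = u (π x)) :
    X.act (f.comp π) x = u.act f (π x) := by
  have h1 : MDifferentiableAt 𝓘(ℝ, E) 𝓘(ℝ, F) π x := π.contMDiff.mdifferentiable (by simp) x
  have h2 := mvfderiv_comp_apply x (f.mdifferentiableAt (π x)) h1 (X x)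
  rw [hu] at h2
  exact h2

theorem lift_act_comp (u : VF F B) (f : Fn F B) :
    (h.lift u).act (f.comp π) = (u.act f).comp π :=
  Fn.ext fun x => VF.act_comp_apply _ u f (h.mfderiv_lift u x)

theorem _root_.SympFib.Vert.act_comp (w : Vert π) (f : Fn F B) : w.1.act (f.comp π) = 0 :=
  Fn.ext fun x => (VF.act_comp_apply w.1 0 f (w.2 x)).trans
    (VF.act_eq_zero_of_apply_eq_zero rfl f)

theorem mfderiv_surjective [T2Space B] (h : Connection π) (x : M) :
    Function.Surjective (mfderiv 𝓘(ℝ, E) 𝓘(ℝ, F) π x) := by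
  intro v
  obtain ⟨u, hu⟩ := VF.exists_apply_eq (π x) v
  exact ⟨h.lift u x, (h.mfderiv_lift u x).trans hu⟩

/-- The projection to the vertical subbundle along the horizontal one, cut off near a point of the
base. In coordinates `Y i` of the base with coordinate fields `e i` it is
`X ↦ X - ∑ i, X(Y i ∘ π) h(e i)`. -/
theorem exists_vertProj [T2Space B] (h : Connection π) (b : B) :
    ∃ (g : Fn F B) (P : VF E M →+ Vert π), (∀ᶠ y in 𝓝 b, g y = 1) ∧
      (∀ f X, P (VF.fmul f X) = Vert.fmul π f (P X)) ∧
      ∀ (X : VF E M) (x : M), mfderiv 𝓘(ℝ, E) 𝓘(ℝ, F) π x (X x) = 0 →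
        (P X).1 x = g (π x) • X x := by
  obtain ⟨g, Y, e, hg, -, he⟩ := VF.exists_frame (E := F) b
  let P₀ : VF E M → VF E M := fun X =>
    VF.fmul (g.comp π) X - ∑ i, VF.fmul (X.act ((Y i).comp π)) (h.lift (e i))
  have hP : ∀ X x, P₀ X x = g (π x) • X x - ∑ i, X.act ((Y i).comp π) x • h.lift (e i) x := by
    intro X x
    change _ - (∑ i, VF.fmul (X.act ((Y i).comp π)) (h.lift (e i))) x = _
    rw [VF.sum_apply]; rfl
  have hV : ∀ X, P₀ X ∈ Vert π := by
    intro X x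
    obtain ⟨u, hu⟩ := VF.exists_apply_eq (π x) (mfderiv 𝓘(ℝ, E) 𝓘(ℝ, F) π x (X x))
    rw [hP, map_sub, map_smul, map_sum, ← hu]
    have h1 := congrArg (fun V : VF F B => V (π x)) (he u)
    simp only [VF.sum_apply, VF.fmul_apply] at h1
    rw [h1, sub_eq_zero]
    refine Finset.sum_congr rfl fun i _ => ?_
    rw [map_smul, h.mfderiv_lift, VF.act_comp_apply X u (Y i) hu.symm]
  refine ⟨g, ⟨⟨fun X => ⟨P₀ X, hV X⟩, ?_⟩, ?_⟩, hg, ?_, ?_⟩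
  · refine Vert.ext fun x => (hP 0 x).trans ?_
    have h0 : ∀ i, (0 : VF E M).act ((Y i).comp π) x = 0 := fun i =>
      VF.act_eq_zero_of_apply_eq_zero rfl _
    have h1 : (0 : VF E M) x = 0 := rfl
    simp only [h0, h1, zero_smul, smul_zero, Finset.sum_const_zero, sub_zero]
    rfl
  · intro X X'
    refine Vert.ext fun x => (hP _ x).trans ?_
    change _ = P₀ X x + P₀ X' x
    simp only [hP, VF.add_act, VF.add_apply, smul_add]
    have h1 : ∀ i, (X.act ((Y i).comp π) + X'.act ((Y i).comp π)) x • h.lift (e i) x =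
      X.act ((Y i).comp π) x • h.lift (e i) x + X'.act ((Y i).comp π) x • h.lift (e i) x :=
      fun i => add_smul _ _ _
    rw [Finset.sum_congr rfl fun i _ => h1 i, Finset.sum_add_distrib]
    abel
  · intro f X
    refine Vert.ext fun x => (hP _ x).trans ?_
    change _ = f x • P₀ X x
    rw [hP, smul_sub, Finset.smul_sum, VF.fmul_apply, smul_comm]
    congr 1
    refine Finset.sum_congr rfl fun i _ => ?_
    rw [VF.fmul_act, smul_smul]; rfl
  · intro X x hx
    refine (hP X x).trans ?_
    rw [Finset.sum_eq_zero, sub_zero]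
    intro i _
    rw [VF.act_comp_apply X 0 (Y i) hx, VF.act_eq_zero_of_apply_eq_zero rfl, zero_smul]

theorem exists_vert_apply_eq [T2Space M] [T2Space B] (h : Connection π) {x : M}
    {v : TangentSpace 𝓘(ℝ, E) x} (hv : mfderiv 𝓘(ℝ, E) 𝓘(ℝ, F) π x v = 0) : ∃ w : Vert π, w.1 x = v := by
  obtain ⟨g, P, hg, -, hP⟩ := h.exists_vertProj (π x)
  obtain ⟨X, rfl⟩ := VF.exists_apply_eq x v
  exact ⟨P X, by rw [hP X x hv, hg.self_of_nhds, one_smul]⟩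

/-- Tensoriality for vertical fields. -/
theorem vert_map_eq_sum [T2Space M] [T2Space B] (h : Connection π) {V : Type*}
    [AddCommGroup V] [Module ℝ V] (x : M) (A : Vert π →+ V) (hA : ∀ f w, A (Vert.fmul π f w) = f x • A w) {ι : Type*}
    [Fintype ι] (c : ι → ℝ) (e : ι → Vert π) {w : Vert π} (hw : w.1 x = ∑ i, c i • (e i).1 x) :
    A w = ∑ i, c i • A (e i) := by
  obtain ⟨g, P, hg, hPf, hP⟩ := h.exists_vertProj (π x)
  let w' := w - ∑ i, Vert.fmul π (algebraMap ℝ (Fn E M) (c i)) (e i)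
  have h0 : w'.1 x = 0 := by
    change w.1 x - (∑ i, Vert.fmul π (algebraMap ℝ (Fn E M) (c i)) (e i)).1 x = 0
    rw [Vert.sum_apply, hw]
    exact sub_self _
  have h1 : P w'.1 = Vert.fmul π (g.comp π) w' := Vert.ext fun y => hP w'.1 y (w'.2 y)
  have h2 : A (P w'.1) = 0 := VF.map_eq_zero_of_apply_eq_zero x (A.comp P)
    (fun f X => by rw [AddMonoidHom.comp_apply, hPf, hA]; rfl) h0
  rw [h1, hA, ContMDiffMap.comp_apply, hg.self_of_nhds, one_smul, map_sub, map_sum,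
    sub_eq_zero] at h2
  rw [h2]
  exact Finset.sum_congr rfl fun i _ => hA _ _

end Connection

/-! ### Solving `i_A σ = θ` for a nondegenerate vertical two-form -/

theorem update_pair_zero {α : Type*} (a b c : α) : Function.update ![a, b] 0 c = ![c, b] := by
  funext i; fin_cases i <;> rfl

theorem update_pair_one {α : Type*} (a b c : α) : Function.update ![a, b] 1 c = ![a, c] := by
  funext i; fin_cases i <;> rfl

section TwoForm

variable {σ : Cochain π 0 2}

theorem IsForm.pair_add_right (hσ : IsForm π σ) (a b c : Vert π) :
    σ ![] ![a, b + c] = σ ![] ![a, b] + σ ![] ![a, c] := by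
  simpa only [update_pair_one] using hσ.vert_add ![] ![a, b] 1 b c

theorem IsForm.pair_add_left (hσ : IsForm π σ) (a b c : Vert π) :
    σ ![] ![a + b, c] = σ ![] ![a, c] + σ ![] ![b, c] := by
  simpa only [update_pair_zero] using hσ.vert_add ![] ![a, c] 0 a b

theorem IsForm.pair_fmul_right (hσ : IsForm π σ) (f : Fn E M) (a b : Vert π) :
    σ ![] ![a, Vert.fmul π f b] = f * σ ![] ![a, b] := by
  simpa only [update_pair_one] using hσ.vert_fmul ![] ![a, b] 1 f b

theorem IsForm.pair_fmul_left (hσ : IsForm π σ) (f : Fn E M) (a b : Vert π) :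
    σ ![] ![Vert.fmul π f a, b] = f * σ ![] ![a, b] := by
  simpa only [update_pair_zero] using hσ.vert_fmul ![] ![a, b] 0 f a

theorem IsForm.pair_self (hσ : IsForm π σ) (a : Vert π) : σ ![] ![a, a] = 0 :=
  hσ.vert_alt ![] ![a, a] 0 1 (by simp) rfl

theorem IsForm.pair_swap (hσ : IsForm π σ) (a b : Vert π) : σ ![] ![a, b] = -σ ![] ![b, a] := by
  have h := hσ.pair_self (a + b)
  rw [hσ.pair_add_left, hσ.pair_add_right, hσ.pair_add_right, hσ.pair_self, hσ.pair_self] at h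
  linear_combination h

/-- The contraction `a ↦ σ(a, b)` as an additive map. -/
def IsForm.pairLeft (hσ : IsForm π σ) (b : Vert π) : Vert π →+ Fn E M :=
  AddMonoidHom.mk' (fun a => σ ![] ![a, b]) fun a c => hσ.pair_add_left a c b

/-- The contraction `b ↦ σ(a, b)` as an additive map. -/
def IsForm.pairRight (hσ : IsForm π σ) (a : Vert π) : Vert π →+ Fn E M :=
  AddMonoidHom.mk' (fun b => σ ![] ![a, b]) fun b c => hσ.pair_add_right a b c

/-- Evaluation of functions at a point. -/
def Fn.eval (x : M) : Fn E M →+* ℝ where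
  toFun f := f x
  map_one' := rfl
  map_mul' _ _ := rfl
  map_zero' := rfl
  map_add' _ _ := rfl

theorem IsForm.eq_of_pair_eq (hσ : IsForm π σ) (nd : IsNondegenerate π σ) {a b : Vert π}
    (hab : ∀ w, σ ![] ![a, w] = σ ![] ![b, w]) : a = b := by
  have h : a - b = 0 := Vert.ext fun x => nd x (a - b) fun w => by
    have h1 : σ ![] ![a - b, w] = 0 :=
      ((hσ.pairLeft w).map_sub a b).trans (sub_eq_zero.2 (hab w))
    rw [h1]; rfl
  exact sub_eq_zero.1 h

/-- Local solution of `i_A σ = D θ` with `D ≠ 0`: for vertical fields `e i` forming a basis at `x₀`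
and their Gram matrix `G`, take `D = det G` and `A = ∑ i, (θ(e) adj G) i • e i`. -/
theorem IsForm.exists_local_pair_eq [T2Space M] [T2Space B] (h : Connection π) (hσ : IsForm π σ)
    (nd : IsNondegenerate π σ) (θ : Vert π →+ Fn E M)
    (hθ : ∀ f w, θ (Vert.fmul π f w) = f * θ w) (x₀ : M) :
    ∃ (A : Vert π) (D : Fn E M), D x₀ ≠ 0 ∧
      ∀ y, D y ≠ 0 → ∀ w, σ ![] ![A, w] y = D y * θ w y := by
  classical
  let K : ∀ x : M, Submodule ℝ (TangentSpace 𝓘(ℝ, E) x) := fun x =>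
    LinearMap.ker (mfderiv 𝓘(ℝ, E) 𝓘(ℝ, F) π x).toLinearMap
  have hfin : ∀ x : M, FiniteDimensional ℝ (TangentSpace 𝓘(ℝ, E) x) := fun x =>
    inferInstanceAs (FiniteDimensional ℝ E)
  have hK : ∀ x, Module.finrank ℝ (K x) = Module.finrank ℝ (K x₀) := by
    have h1 : ∀ x, Module.finrank ℝ F + Module.finrank ℝ (K x) = Module.finrank ℝ E := by
      intro x
      have h2 := LinearMap.finrank_range_add_finrank_ker
        (mfderiv 𝓘(ℝ, E) 𝓘(ℝ, F) π x).toLinearMap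
      rw [LinearMap.range_eq_top.2 (h.mfderiv_surjective x), finrank_top] at h2
      exact h2
    intro x
    have := h1 x
    have := h1 x₀
    omega
  let r := Module.finrank ℝ (K x₀)
  let b : Module.Basis (Fin r) ℝ (K x₀) := Module.finBasis ℝ (K x₀)
  choose e he using fun i => h.exists_vert_apply_eq (b i).2
  let G : Matrix (Fin r) (Fin r) (Fn E M) := fun i j => σ ![] ![e i, e j]
  have hGy : ∀ y, G.det y = ((Fn.eval y).mapMatrix G).det := fun y => (Fn.eval y).map_det G
  let ey : ∀ y, Fin r → K y := fun y i => ⟨(e i).1 y, (e i).2 y⟩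
  -- where the Gram determinant does not vanish, the `e i` form a basis of the vertical space
  have hli : ∀ y, G.det y ≠ 0 → LinearIndependent ℝ (ey y) := by
    intro y hy
    rw [Fintype.linearIndependent_iff]
    intro c hc
    have h0 : ((0 : Vert π).1 y) = ∑ i, c i • (e i).1 y := by
      have := congrArg Subtype.val hc
      simp only [AddSubmonoidClass.coe_finsetSum] at this
      exact this.symm
    have h1 : Matrix.vecMul c ((Fn.eval y).mapMatrix G) = 0 := by
      funext j
      have h2 := h.vert_map_eq_sum y ((Fn.eval y).toAddMonoidHom.comp (hσ.pairLeft (e j)))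
        (fun f w => congrArg (fun g : Fn E M => g y) (hσ.pair_fmul_left f w (e j))) c e h0
      rw [map_zero] at h2
      exact h2.symm
    exact fun i => congrFun (Matrix.eq_zero_of_vecMul_eq_zero (hGy y ▸ hy) h1) i
  have hspan : ∀ y, G.det y ≠ 0 → ∀ w : Vert π, ∃ c : Fin r → ℝ,
      w.1 y = ∑ i, c i • (e i).1 y := by
    intro y hy w
    have h1 := (hli y hy).span_eq_top_of_card_eq_finrank' (by rw [hK y, Fintype.card_fin])
    have h2 : (⟨w.1 y, w.2 y⟩ : K y) ∈ Submodule.span ℝ (Set.range (ey y)) := h1 ▸ trivial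
    obtain ⟨c, hc⟩ := (Submodule.mem_span_range_iff_exists_fun ℝ).1 h2
    have := congrArg Subtype.val hc
    simp only [AddSubmonoidClass.coe_finsetSum] at this
    exact ⟨c, this.symm⟩
  let c : Fin r → Fn E M := Matrix.vecMul (fun j => θ (e j)) G.adjugate
  refine ⟨∑ i, Vert.fmul π (c i) (e i), G.det, ?_, fun y hy w => ?_⟩
  · rw [hGy]
    intro h0
    obtain ⟨c, hc, hcG⟩ := Matrix.exists_vecMul_eq_zero_iff.2 h0
    let a : Vert π := ∑ i, Vert.fmul π (algebraMap ℝ (Fn E M) (c i)) (e i)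
    have ha : a.1 x₀ = ∑ i, c i • (e i).1 x₀ := Vert.sum_apply _ _ _
    have h1 : a.1 x₀ = 0 := by
      refine nd x₀ a fun w => ?_
      have hb : w.1 x₀ = ∑ i, b.repr ⟨w.1 x₀, w.2 x₀⟩ i • (e i).1 x₀ := by
        have h3 := congrArg Subtype.val (b.sum_repr ⟨w.1 x₀, w.2 x₀⟩)
        simp only [AddSubmonoidClass.coe_finsetSum] at h3
        refine h3.symm.trans (Finset.sum_congr rfl fun i _ => ?_)
        rw [he i]; rfl
      have h4 := h.vert_map_eq_sum x₀ ((Fn.eval x₀).toAddMonoidHom.comp (hσ.pairRight a))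
        (fun f w => congrArg (fun g : Fn E M => g x₀) (hσ.pair_fmul_right f a w)) _ e hb
      refine h4.trans (Finset.sum_eq_zero fun j _ => ?_)
      have h5 := h.vert_map_eq_sum x₀ ((Fn.eval x₀).toAddMonoidHom.comp (hσ.pairLeft (e j)))
        (fun f w => congrArg (fun g : Fn E M => g x₀) (hσ.pair_fmul_left f w (e j))) c e ha
      have h6 : σ ![] ![a, e j] x₀ = 0 := h5.trans (congrFun hcG j)
      exact (congrArg _ h6).trans (smul_zero _)
    apply hc
    have h2 : ∑ i, c i • b i = 0 := by
      apply Subtype.ext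
      simp only [AddSubmonoidClass.coe_finsetSum]
      refine Eq.trans (Finset.sum_congr rfl fun i _ => ?_) (ha.symm.trans h1)
      rw [he i]; rfl
    exact funext (Fintype.linearIndependent_iff.1 b.linearIndependent c h2)
  · obtain ⟨d, hd⟩ := hspan y hy w
    have hAe : ∀ j, σ ![] ![∑ i, Vert.fmul π (c i) (e i), e j] = G.det * θ (e j) := by
      intro j
      have h1 : σ ![] ![∑ i, Vert.fmul π (c i) (e i), e j] = ∑ i, c i * G i j :=
        (map_sum (hσ.pairLeft (e j)) _ _).trans
          (Finset.sum_congr rfl fun i _ => hσ.pair_fmul_left _ _ _)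
      have h2 : Matrix.vecMul c G = G.det • fun j => θ (e j) := by
        rw [Matrix.vecMul_vecMul, Matrix.adjugate_mul, Matrix.vecMul_smul, Matrix.vecMul_one]
      exact h1.trans (congrFun h2 j)
    have h4 := h.vert_map_eq_sum y ((Fn.eval y).toAddMonoidHom.comp
      (hσ.pairRight (∑ i, Vert.fmul π (c i) (e i))))
      (fun f w => congrArg (fun g : Fn E M => g y) (hσ.pair_fmul_right f _ w)) d e hd
    have h5 := h.vert_map_eq_sum y ((Fn.eval y).toAddMonoidHom.comp θ)
      (fun f w => congrArg (fun g : Fn E M => g y) (hθ f w)) d e hd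
    refine h4.trans (Eq.trans ?_ (congrArg (G.det y * ·) h5).symm)
    rw [Finset.mul_sum]
    refine Finset.sum_congr rfl fun j _ => ?_
    have h6 := congrArg (fun g : Fn E M => g y) (hAe j)
    change d j • σ ![] ![∑ i, Vert.fmul π (c i) (e i), e j] y = _ * (d j • θ (e j) y)
    rw [mul_smul_comm]
    exact congrArg (d j • ·) h6

/-- A nondegenerate vertical two-form identifies vertical vector fields with vertical one-forms. -/
theorem IsForm.exists_pair_eq [T2Space M] [T2Space B] (h : Connection π) (hσ : IsForm π σ)
    (nd : IsNondegenerate π σ) (θ : Vert π →+ Fn E M)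
    (hθ : ∀ f w, θ (Vert.fmul π f w) = f * θ w) : ∃ A : Vert π, ∀ w, σ ![] ![A, w] = θ w := by
  choose A D hD hA using hσ.exists_local_pair_eq h nd θ hθ
  -- the local solutions agree where they are defined, since `σ` is nondegenerate
  have huniq : ∀ x y, D x y ≠ 0 → (D y y)⁻¹ • (A y).1 y = (D x y)⁻¹ • (A x).1 y := by
    intro x y hxy
    let a : Vert π := Vert.fmul π (algebraMap ℝ (Fn E M) (D y y)⁻¹) (A y) -
      Vert.fmul π (algebraMap ℝ (Fn E M) (D x y)⁻¹) (A x)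
    refine sub_eq_zero.1 (nd y a fun w => ?_)
    have h1 : σ ![] ![a, w] = _ := (hσ.pairLeft w).map_sub _ _
    have h2 : σ ![] ![a, w] y = (D y y)⁻¹ * σ ![] ![A y, w] y - (D x y)⁻¹ * σ ![] ![A x, w] y := by
      rw [h1]
      exact congrArg₂ (fun f g : Fn E M => f y - g y) (hσ.pair_fmul_left _ _ _)
        (hσ.pair_fmul_left _ _ _)
    rw [h2, hA y y (hD y), hA x y hxy, inv_mul_cancel_left₀ (hD y), inv_mul_cancel_left₀ hxy,
      sub_self]
  let V : VF E M := ⟨fun y => (D y y)⁻¹ • (A y).1 y, by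
    intro x
    have h1 : ContMDiffAt 𝓘(ℝ, E) 𝓘(ℝ, ℝ) ∞ (fun y => (D x y)⁻¹) x :=
      (D x).contMDiff.contMDiffAt.inv₀ (hD x)
    refine (h1.smul_section ((A x).1.contMDiff x)).congr_of_eventuallyEq ?_
    filter_upwards [(D x).contMDiff.continuous.continuousAt.eventually_ne (hD x)] with y hy
    exact congrArg (Bundle.TotalSpace.mk y) (huniq x y hy)⟩
  have hV : V ∈ Vert π := by
    intro y
    change mfderiv 𝓘(ℝ, E) 𝓘(ℝ, F) π y ((D y y)⁻¹ • (A y).1 y) = 0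
    rw [map_smul, (A y).2 y, smul_zero]
  refine ⟨⟨V, hV⟩, fun w => Fn.ext fun y => ?_⟩
  have h1 := h.vert_map_eq_sum y ((Fn.eval y).toAddMonoidHom.comp (hσ.pairLeft w))
    (fun f a => congrArg (fun g : Fn E M => g y) (hσ.pair_fmul_left f a w))
    (fun _ : Fin 1 => (D y y)⁻¹) (fun _ => A y) (w := ⟨V, hV⟩) (by
      rw [Fin.sum_univ_one]; rfl)
  rw [Fin.sum_univ_one] at h1
  refine h1.trans ?_
  change (D y y)⁻¹ * σ ![] ![A y, w] y = _
  rw [hA y y (hD y), inv_mul_cancel_left₀ (hD y)]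

end TwoForm

/-! ### Forms of low degree -/

theorem eta_one {α : Type*} (v : Fin 1 → α) : v = ![v 0] := by
  funext i; fin_cases i; rfl

theorem eta_two {α : Type*} (v : Fin 2 → α) : v = ![v 0, v 1] := by
  funext i; fin_cases i <;> rfl

theorem eta_three {α : Type*} (v : Fin 3 → α) : v = ![v 0, v 1, v 2] := by
  funext i; fin_cases i <;> rfl

theorem cochain_ext_one_one {Λ Λ' : Cochain π 1 1} (h : ∀ u w, Λ ![u] ![w] = Λ' ![u] ![w]) :
    Λ = Λ' := by
  funext u w
  rw [eta_one u, eta_one w, h]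

theorem cochain_ext_two_one {Λ Λ' : Cochain π 2 1}
    (h : ∀ u v w, Λ ![u, v] ![w] = Λ' ![u, v] ![w]) : Λ = Λ' := by
  funext u w
  rw [eta_two u, eta_one w, h]

theorem cochain_ext_three_one {Λ Λ' : Cochain π 3 1}
    (h : ∀ u v t w, Λ ![u, v, t] ![w] = Λ' ![u, v, t] ![w]) : Λ = Λ' := by
  funext u w
  rw [eta_three u, eta_one w, h]

section Multilinear

variable {p : ℕ} {Λ : Cochain π p 1}

theorem IsForm.single_add (hΛ : IsForm π Λ) (u : Fin p → VF F B) (a b : Vert π) :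
    Λ u ![a + b] = Λ u ![a] + Λ u ![b] := by
  have h := hΛ.vert_add u ![a] 0 a b
  rwa [eta_one (Function.update _ _ _), eta_one (Function.update _ _ a),
    eta_one (Function.update _ _ b), Function.update_self, Function.update_self,
    Function.update_self] at h

theorem IsForm.single_fmul (hΛ : IsForm π Λ) (u : Fin p → VF F B) (f : Fn E M) (a : Vert π) :
    Λ u ![Vert.fmul π f a] = f * Λ u ![a] := by
  have h := hΛ.vert_fmul u ![a] 0 f a
  rwa [eta_one (Function.update _ _ _), eta_one (Function.update _ _ a),
    Function.update_self, Function.update_self] at h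

/-- The values of a form in `Ω^p(B, Ω¹(Ver))`, as additive maps. -/
def IsForm.single (hΛ : IsForm π Λ) (u : Fin p → VF F B) : Vert π →+ Fn E M :=
  AddMonoidHom.mk' (fun a => Λ u ![a]) (hΛ.single_add u)

end Multilinear

theorem isForm_one_one {α : VF F B → Vert π → Fn E M}
    (base_add : ∀ u v w, α (u + v) w = α u w + α v w)
    (base_fmul : ∀ f u w, α (VF.fmul f u) w = f.comp π * α u w)
    (vert_add : ∀ u w w', α u (w + w') = α u w + α u w')
    (vert_fmul : ∀ u f w, α u (Vert.fmul π f w) = f * α u w) :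
    IsForm π (fun u w => α (u 0) (w 0) : Cochain π 1 1) where
  base_add u w i a b := by
    obtain rfl := Subsingleton.elim i 0
    simp only [Function.update_self, base_add]
  base_fmul u w i f a := by
    obtain rfl := Subsingleton.elim i 0
    simp only [Function.update_self, base_fmul]
  base_alt u w i j hij _ := absurd (Subsingleton.elim i j) hij
  vert_add u w i a b := by
    obtain rfl := Subsingleton.elim i 0
    simp only [Function.update_self, vert_add]
  vert_fmul u w i f a := by
    obtain rfl := Subsingleton.elim i 0
    simp only [Function.update_self, vert_fmul]
  vert_alt u w i j hij _ := absurd (Subsingleton.elim i j) hij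

theorem isForm_two_one {Θ : VF F B → VF F B → Vert π → Fn E M}
    (base_add : ∀ u u' v w, Θ (u + u') v w = Θ u v w + Θ u' v w)
    (base_fmul : ∀ f u v w, Θ (VF.fmul f u) v w = f.comp π * Θ u v w)
    (base_self : ∀ u w, Θ u u w = 0)
    (base_swap : ∀ u v w, Θ u v w = -Θ v u w)
    (vert_add : ∀ u v w w', Θ u v (w + w') = Θ u v w + Θ u v w')
    (vert_fmul : ∀ u v f w, Θ u v (Vert.fmul π f w) = f * Θ u v w) :
    IsForm π (fun u w => Θ (u 0) (u 1) (w 0) : Cochain π 2 1) where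
  base_add u w i a b := by
    fin_cases i
    · simp [base_add]
    · simp only [Fin.mk_one, ne_eq, Fin.isValue, zero_ne_one, not_false_eq_true,
        Function.update_of_ne, Function.update_self]
      rw [base_swap, base_add, base_swap a, base_swap b]; ring
  base_fmul u w i f a := by
    fin_cases i
    · simp [base_fmul]
    · simp only [Fin.mk_one, ne_eq, Fin.isValue, zero_ne_one, not_false_eq_true,
        Function.update_of_ne, Function.update_self]
      rw [base_swap, base_fmul, base_swap a]; ring
  base_alt u w i j hij e := by
    have h : u 0 = u 1 := by
      fin_cases i <;> fin_cases j <;> first | exact absurd rfl hij | exact e | exact e.symm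
    simp only [h, base_self]
  vert_add u w i a b := by
    obtain rfl := Subsingleton.elim i 0
    simp only [Function.update_self, vert_add]
  vert_fmul u w i f a := by
    obtain rfl := Subsingleton.elim i 0
    simp only [Function.update_self, vert_fmul]
  vert_alt u w i j hij _ := absurd (Subsingleton.elim i j) hij

theorem isForm_two_zero {ψ : VF F B → VF F B → Fn E M}
    (base_add : ∀ u u' v, ψ (u + u') v = ψ u v + ψ u' v)
    (base_fmul : ∀ f u v, ψ (VF.fmul f u) v = f.comp π * ψ u v)
    (base_self : ∀ u, ψ u u = 0) (base_swap : ∀ u v, ψ u v = -ψ v u) :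
    IsForm π (fun u _ => ψ (u 0) (u 1) : Cochain π 2 0) where
  base_add u w i a b := by
    fin_cases i
    · simp [base_add]
    · simp only [Fin.mk_one, ne_eq, Fin.isValue, zero_ne_one, not_false_eq_true,
        Function.update_of_ne, Function.update_self]
      rw [base_swap, base_add, base_swap a, base_swap b]; ring
  base_fmul u w i f a := by
    fin_cases i
    · simp [base_fmul]
    · simp only [Fin.mk_one, ne_eq, Fin.isValue, zero_ne_one, not_false_eq_true,
        Function.update_of_ne, Function.update_self]
      rw [base_swap, base_fmul, base_swap a]; ring
  base_alt u w i j hij e := by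
    have h : u 0 = u 1 := by
      fin_cases i <;> fin_cases j <;> first | exact absurd rfl hij | exact e | exact e.symm
    simp only [h, base_self]
  vert_add u w i := i.elim0
  vert_fmul u w i := i.elim0
  vert_alt u w i := i.elim0

theorem isForm_three_zero {ψ : VF F B → VF F B → VF F B → Fn E M}
    (base_add : ∀ u u' v t, ψ (u + u') v t = ψ u v t + ψ u' v t)
    (base_fmul : ∀ f u v t, ψ (VF.fmul f u) v t = f.comp π * ψ u v t)
    (base_self : ∀ u t, ψ u u t = 0) (base_swap : ∀ u v t, ψ u v t = -ψ v u t)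
    (base_swap' : ∀ u v t, ψ u v t = -ψ u t v) :
    IsForm π (fun u _ => ψ (u 0) (u 1) (u 2) : Cochain π 3 0) where
  base_add u w i a b := by
    fin_cases i
    · simp [base_add]
    · change ψ (u 0) (a + b) (u 2) = ψ (u 0) a (u 2) + ψ (u 0) b (u 2)
      rw [base_swap, base_add, base_swap a, base_swap b]; ring
    · change ψ (u 0) (u 1) (a + b) = ψ (u 0) (u 1) a + ψ (u 0) (u 1) b
      rw [base_swap', base_swap, base_add, base_swap a, base_swap b, base_swap' _ a,
        base_swap' _ b]; ring
  base_fmul u w i f a := by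
    fin_cases i
    · simp [base_fmul]
    · change ψ (u 0) (VF.fmul f a) (u 2) = f.comp π * ψ (u 0) a (u 2)
      rw [base_swap, base_fmul, base_swap a]; ring
    · change ψ (u 0) (u 1) (VF.fmul f a) = f.comp π * ψ (u 0) (u 1) a
      rw [base_swap', base_swap, base_fmul, base_swap a, base_swap' _ a]; ring
  base_alt u w i j hij e := by
    have h : u 0 = u 1 ∨ u 1 = u 2 ∨ u 0 = u 2 := by
      fin_cases i <;> fin_cases j <;> first
        | exact absurd rfl hij
        | exact Or.inl e
        | exact Or.inl e.symm
        | exact Or.inr (Or.inl e)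
        | exact Or.inr (Or.inl e.symm)
        | exact Or.inr (Or.inr e)
        | exact Or.inr (Or.inr e.symm)
    rcases h with h | h | h
    · simp only [h, base_self]
    · change ψ (u 0) (u 1) (u 2) = 0
      rw [base_swap, base_swap', h, base_self, neg_zero, neg_zero]
    · change ψ (u 0) (u 1) (u 2) = 0
      rw [base_swap', h, base_self, neg_zero]
  vert_add u w i := i.elim0
  vert_fmul u w i := i.elim0
  vert_alt u w i := i.elim0

/-! ### The differentials in low degree -/

theorem koszul_zero_apply {L N : Type*} [AddCommGroup N] [Module ℝ N] (act : L → N →ₗ[ℝ] N)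
    (br : L → L → L) (Λ : (Fin 0 → L) → N) (v : Fin 1 → L) :
    koszul act br 0 Λ v = act (v 0) (Λ ![]) := by
  simp [koszul, Subsingleton.elim _ ![]]

theorem koszul_one_apply {L N : Type*} [AddCommGroup N] [Module ℝ N] (act : L → N →ₗ[ℝ] N)
    (br : L → L → L) (Λ : (Fin 1 → L) → N) (a b : L) :
    koszul act br 1 Λ ![a, b] = act a (Λ ![b]) - act b (Λ ![a]) - Λ ![br a b] := by
  have e1 : (fun k : Fin 1 => ![a, b] ((0 : Fin 2).succAbove k)) = ![b] := eta_one _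
  have e2 : (fun k : Fin 1 => ![a, b] ((1 : Fin 2).succAbove k)) = ![a] := eta_one _
  have e3 : (fun k : Fin 1 => Function.update ![a, b] 0 (br a b) ((1 : Fin 2).succAbove k)) =
    ![br a b] := eta_one _
  change (∑ i : Fin 2, (_ : N)) + ∑ i : Fin 2, ∑ j : Fin 2, (_ : N) = _
  rw [Fin.sum_univ_two, Fin.sum_univ_two, Fin.sum_univ_two, Fin.sum_univ_two]
  simp only [Matrix.cons_val_zero, Matrix.cons_val_one, e1, e2, e3]
  simp
  abel

theorem koszul_two_apply {L N : Type*} [AddCommGroup N] [Module ℝ N] (act : L → N →ₗ[ℝ] N)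
    (br : L → L → L) (Λ : (Fin 2 → L) → N) (a b c : L) :
    koszul act br 2 Λ ![a, b, c] = act a (Λ ![b, c]) - act b (Λ ![a, c]) + act c (Λ ![a, b])
      - Λ ![br a b, c] + Λ ![br a c, b] + Λ ![a, br b c] := by
  have e1 : (fun k : Fin 2 => ![a, b, c] ((0 : Fin 3).succAbove k)) = ![b, c] := eta_two _
  have e2 : (fun k : Fin 2 => ![a, b, c] ((1 : Fin 3).succAbove k)) = ![a, c] := eta_two _
  have e3 : (fun k : Fin 2 => ![a, b, c] ((2 : Fin 3).succAbove k)) = ![a, b] := eta_two _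
  have e4 : (fun k : Fin 2 => Function.update ![a, b, c] 0 (br a b) ((1 : Fin 3).succAbove k)) =
    ![br a b, c] := eta_two _
  have e5 : (fun k : Fin 2 => Function.update ![a, b, c] 0 (br a c) ((2 : Fin 3).succAbove k)) =
    ![br a c, b] := eta_two _
  have e6 : (fun k : Fin 2 => Function.update ![a, b, c] 1 (br b c) ((2 : Fin 3).succAbove k)) =
    ![a, br b c] := eta_two _
  have v2 : ![a, b, c] 2 = c := rfl
  change (∑ i : Fin 3, (_ : N)) + ∑ i : Fin 3, ∑ j : Fin 3, (_ : N) = _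
  rw [Fin.sum_univ_three, Fin.sum_univ_three, Fin.sum_univ_three, Fin.sum_univ_three,
    Fin.sum_univ_three]
  simp only [Matrix.cons_val_zero, Matrix.cons_val_one, v2, e1, e2, e3, e4, e5, e6]
  simp
  abel

theorem dVer_zero_apply (p : ℕ) (ψ : Cochain π p 0) (u : Fin p → VF F B) (w : Vert π) :
    dVer π p 0 ψ u ![w] = (-1 : ℝ) ^ p • w.1.act (ψ u ![]) :=
  congrArg ((-1 : ℝ) ^ p • ·) (koszul_zero_apply _ _ (ψ u) ![w])

theorem dVer_one_apply (p : ℕ) (Λ : Cochain π p 1) (u : Fin p → VF F B) (a b : Vert π) :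
    dVer π p 1 Λ u ![a, b] = (-1 : ℝ) ^ p •
      (a.1.act (Λ u ![b]) - b.1.act (Λ u ![a]) - Λ u ![Vert.bracket π a b]) :=
  congrArg ((-1 : ℝ) ^ p • ·) (koszul_one_apply _ _ (Λ u) a b)

theorem dVer_two_apply (σ : Cochain π 0 2) (u : Fin 0 → VF F B) (a b c : Vert π) :
    dVer π 0 2 σ u ![a, b, c] = a.1.act (σ u ![b, c]) - b.1.act (σ u ![a, c])
      + c.1.act (σ u ![a, b]) - σ u ![Vert.bracket π a b, c] + σ u ![Vert.bracket π a c, b]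
      + σ u ![a, Vert.bracket π b c] :=
  (congrArg ((-1 : ℝ) ^ 0 • ·) (koszul_two_apply _ _ (σ u) a b c)).trans (by
    rw [pow_zero, one_smul]; rfl)

theorem dVer_one_eq_zero_iff {p : ℕ} {Λ : Cochain π p 1} :
    dVer π p 1 Λ = 0 ↔ ∀ u a b,
      Λ u ![Vert.bracket π a b] = a.1.act (Λ u ![b]) - b.1.act (Λ u ![a]) := by
  constructor
  · intro h u a b
    have h1 := congrFun (congrFun h u) ![a, b]
    rw [dVer_one_apply] at h1
    exact (sub_eq_zero.1 ((smul_eq_zero.1 h1).resolve_left (by simp))).symm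
  · intro h
    funext u w
    rw [eta_two w, dVer_one_apply, h, sub_self, smul_zero]; rfl

theorem mem_closedForm_iff {p : ℕ} {Λ : Cochain π p 1} :
    Λ ∈ closedForm π p 1 ↔ IsForm π Λ ∧ ∀ u a b,
      Λ u ![Vert.bracket π a b] = a.1.act (Λ u ![b]) - b.1.act (Λ u ![a]) :=
  and_congr Iff.rfl (LinearMap.mem_ker.trans dVer_one_eq_zero_iff)

section BasePair

variable {q : ℕ} {Λ : Cochain π 2 q}

theorem IsForm.base_pair_add_left (hΛ : IsForm π Λ) (u u' v : VF F B) (w : Fin q → Vert π) :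
    Λ ![u + u', v] w = Λ ![u, v] w + Λ ![u', v] w := by
  simpa only [update_pair_zero] using hΛ.base_add ![u, v] w 0 u u'

theorem IsForm.base_pair_fmul_left (hΛ : IsForm π Λ) (f : Fn F B) (u v : VF F B)
    (w : Fin q → Vert π) : Λ ![VF.fmul f u, v] w = f.comp π * Λ ![u, v] w := by
  simpa only [update_pair_zero] using hΛ.base_fmul ![u, v] w 0 f u

theorem IsForm.base_pair_self (hΛ : IsForm π Λ) (u : VF F B) (w : Fin q → Vert π) :
    Λ ![u, u] w = 0 :=
  hΛ.base_alt ![u, u] w 0 1 (by simp) rfl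

theorem IsForm.base_pair_add_right (hΛ : IsForm π Λ) (u v v' : VF F B) (w : Fin q → Vert π) :
    Λ ![u, v + v'] w = Λ ![u, v] w + Λ ![u, v'] w := by
  simpa only [update_pair_one] using hΛ.base_add ![u, v] w 1 v v'

theorem IsForm.base_pair_swap (hΛ : IsForm π Λ) (u v : VF F B) (w : Fin q → Vert π) :
    Λ ![u, v] w = -Λ ![v, u] w := by
  have h := hΛ.base_pair_self (u + v) w
  rw [hΛ.base_pair_add_left, hΛ.base_pair_add_right, hΛ.base_pair_add_right,
    hΛ.base_pair_self, hΛ.base_pair_self] at h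
  linear_combination h

theorem IsForm.base_single_add {Λ : Cochain π 1 q} (hΛ : IsForm π Λ) (u u' : VF F B)
    (w : Fin q → Vert π) : Λ ![u + u'] w = Λ ![u] w + Λ ![u'] w := by
  have h := hΛ.base_add ![u] w 0 u u'
  rwa [eta_one (Function.update _ _ _), eta_one (Function.update _ _ u),
    eta_one (Function.update _ _ u'), Function.update_self, Function.update_self,
    Function.update_self] at h

theorem IsForm.base_single_fmul {Λ : Cochain π 1 q} (hΛ : IsForm π Λ) (f : Fn F B) (u : VF F B)
    (w : Fin q → Vert π) : Λ ![VF.fmul f u] w = f.comp π * Λ ![u] w := by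
  have h := hΛ.base_fmul ![u] w 0 f u
  rwa [eta_one (Function.update _ _ _), eta_one (Function.update _ _ u),
    Function.update_self, Function.update_self] at h

end BasePair

/-- The vertical differential of a function is linear over functions and closed. -/
theorem exactForm_two_one_le : exactForm π 2 1 ≤ closedForm π 2 1 := by
  rintro _ ⟨ψ, hψ, rfl⟩
  have hψ' : IsForm π ψ := hψ
  have e : ∀ u w, dVer π 2 0 ψ u w = (w 0).1.act (ψ ![u 0, u 1] ![]) := fun u w => by
    rw [eta_one w, dVer_zero_apply, eta_two u]; simp
  have e' : dVer π 2 0 ψ = fun u w => (w 0).1.act (ψ ![u 0, u 1] ![]) :=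
    funext fun u => funext fun w => e u w
  rw [mem_closedForm_iff]
  refine ⟨?_, fun u a b => ?_⟩
  · rw [e']
    refine isForm_two_one (Θ := fun u v w => w.1.act (ψ ![u, v] ![])) ?_ ?_ ?_ ?_ ?_ ?_
    · intro u u' v w
      rw [hψ'.base_pair_add_left, VF.act_add]
    · intro f u v w
      rw [hψ'.base_pair_fmul_left, VF.act_mul, Vert.act_comp, zero_mul, zero_add]
    · intro u w
      rw [hψ'.base_pair_self, VF.act_zero]
    · intro u v w
      rw [hψ'.base_pair_swap, VF.act_neg]
    · intro u v w w'
      exact VF.add_act _ _ _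
    · intro u v f w
      exact VF.fmul_act _ _ _
  · rw [e, e, e]
    exact VF.bracket_act _ _ _

namespace Connection

/-- The bracket `[h(u), w]` of a horizontal lift with a vertical field. -/
def lieV (h : Connection π) (u : VF F B) (w : Vert π) : Vert π :=
  Vert.bracketOf π (h.lift u) u (h.mfderiv_lift u) w

variable (h : Connection π)

theorem lieDeriv_one_apply (u : VF F B) (η : (Fin 1 → Vert π) → Fn E M) (w : Vert π) :
    h.lieDeriv 1 u η ![w] = (h.lift u).act (η ![w]) - η ![h.lieV u w] := by
  change _ - ∑ k : Fin 1, (_ : Fn E M) = _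
  rw [Fin.sum_univ_one, eta_one (Function.update _ _ _), Function.update_self]
  rfl

theorem lieDeriv_two_apply (u : VF F B) (η : (Fin 2 → Vert π) → Fn E M) (a b : Vert π) :
    h.lieDeriv 2 u η ![a, b] =
      (h.lift u).act (η ![a, b]) - (η ![h.lieV u a, b] + η ![a, h.lieV u b]) := by
  change _ - ∑ k : Fin 2, (_ : Fn E M) = _
  rw [Fin.sum_univ_two, update_pair_zero, update_pair_one]
  rfl

theorem dHor_one_apply (Λ : Cochain π 1 1) (u v : VF F B) (w : Vert π) :
    h.dHor 1 1 Λ ![u, v] ![w] =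
      (h.lift u).act (Λ ![v] ![w]) - Λ ![v] ![h.lieV u w]
      - ((h.lift v).act (Λ ![u] ![w]) - Λ ![u] ![h.lieV v w])
      - Λ ![u.bracket v] ![w] := by
  rw [← lieDeriv_one_apply, ← lieDeriv_one_apply]
  exact congrFun (koszul_one_apply (h.lieDeriv 1) VF.bracket Λ u v) ![w]

theorem dHor_two_apply (Λ : Cochain π 2 1) (u v t : VF F B) (w : Vert π) :
    h.dHor 2 1 Λ ![u, v, t] ![w] =
      (h.lift u).act (Λ ![v, t] ![w]) - Λ ![v, t] ![h.lieV u w]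
      - ((h.lift v).act (Λ ![u, t] ![w]) - Λ ![u, t] ![h.lieV v w])
      + ((h.lift t).act (Λ ![u, v] ![w]) - Λ ![u, v] ![h.lieV t w])
      - Λ ![u.bracket v, t] ![w] + Λ ![u.bracket t, v] ![w] + Λ ![u, v.bracket t] ![w] := by
  rw [← lieDeriv_one_apply, ← lieDeriv_one_apply, ← lieDeriv_one_apply]
  exact congrFun (koszul_two_apply (h.lieDeriv 1) VF.bracket Λ u v t) ![w]

theorem isSymplectic_iff {σ : Cochain π 0 2} : h.IsSymplectic σ ↔ ∀ u a b,
    (h.lift u).act (σ ![] ![a, b]) = σ ![] ![h.lieV u a, b] + σ ![] ![a, h.lieV u b] := by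
  have e : ∀ u a b, h.dHor 0 2 σ u ![a, b] = (h.lift (u 0)).act (σ ![] ![a, b]) -
      (σ ![] ![h.lieV (u 0) a, b] + σ ![] ![a, h.lieV (u 0) b]) := fun u a b => by
    rw [← lieDeriv_two_apply]
    exact congrFun (koszul_zero_apply (h.lieDeriv 2) VF.bracket σ u) ![a, b]
  constructor
  · intro hs u a b
    exact sub_eq_zero.1 ((e ![u] a b).symm.trans (congrFun (congrFun hs ![u]) ![a, b]))
  · intro hs
    funext u w
    rw [eta_two w, e, hs, sub_self]; rfl

theorem dCurv_apply (σ : Cochain π 0 2) (u v : VF F B) (w : Vert π) :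
    h.dCurv 0 1 σ ![u, v] ![w] = -σ ![] ![h.curvature u v, w] := by
  change (-1 : ℝ) ^ 0 • ∑ i : Fin 1, ∑ j : Fin 2, _ = _
  rw [Fin.sum_univ_one, Fin.sum_univ_two]
  have e : (Fin.cons (h.curvature u v) ![w] : Fin 2 → Vert π) = ![h.curvature u v, w] := rfl
  simp [e, Subsingleton.elim (fun _ : Fin 0 => v) ![]]

/-! ### The difference of two connections -/

/-- The difference `h'(u) - h(u)` of two horizontal lifts. -/
def diff (h h' : Connection π) (u : VF F B) : Vert π :=
  ⟨h'.lift u - h.lift u, fun x => by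
    rw [VF.sub_apply, map_sub, h.mfderiv_lift, h'.mfderiv_lift, sub_self]⟩

variable (h' : Connection π)

theorem lift_eq_add_diff (u : VF F B) : h'.lift u = h.lift u + (h.diff h' u).1 :=
  (add_sub_cancel _ _).symm

theorem diff_add (u v : VF F B) : h.diff h' (u + v) = h.diff h' u + h.diff h' v := by
  apply Subtype.ext
  change h'.lift (u + v) - h.lift (u + v) = h'.lift u - h.lift u + (h'.lift v - h.lift v)
  rw [lift_add, lift_add]; abel

theorem diff_fmul (f : Fn F B) (u : VF F B) :
    h.diff h' (VF.fmul f u) = Vert.fmul π (f.comp π) (h.diff h' u) := by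
  apply Vert.ext
  intro x
  change h'.lift (VF.fmul f u) x - h.lift (VF.fmul f u) x =
    f (π x) • (h'.lift u x - h.lift u x)
  rw [lift_fmul, lift_fmul, smul_sub]; rfl

theorem lieV_eq_add_diff (u : VF F B) (w : Vert π) :
    h'.lieV u w = h.lieV u w + Vert.bracket π (h.diff h' u) w := by
  apply Subtype.ext
  change (h'.lift u).bracket w.1 = (h.lift u).bracket w.1 + (h.diff h' u).1.bracket w.1
  rw [← VF.bracket_add_left, ← lift_eq_add_diff]

/-- For a closed one-form `η`, Cartan's formula gives `L_{h'(u)} η - L_{h(u)} η = d (η(A))` with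
`A = h'(u) - h(u)`. -/
theorem lie_one_sub_lie_one {p : ℕ} {Λ : Cochain π p 1} (hΛ : Λ ∈ closedForm π p 1)
    (v : Fin p → VF F B) (u : VF F B) (w : Vert π) :
    (h'.lift u).act (Λ v ![w]) - Λ v ![h'.lieV u w] =
      (h.lift u).act (Λ v ![w]) - Λ v ![h.lieV u w] + w.1.act (Λ v ![h.diff h' u]) := by
  obtain ⟨hf, hc⟩ := mem_closedForm_iff.1 hΛ
  rw [lieV_eq_add_diff h h', hf.single_add, hc, lift_eq_add_diff h h', VF.add_act]
  ring

end Connection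

namespace Connection

section Independence

variable (h h' : Connection π)

theorem dHor_one_sub_mem_exactForm {Λ : Cochain π 1 1} (hΛ : Λ ∈ closedForm π 1 1) :
    h'.dHor 1 1 Λ - h.dHor 1 1 Λ ∈ exactForm π 2 1 := by
  have hf : IsForm π Λ := hΛ.1
  refine ⟨fun u _ => Λ ![u 1] ![h.diff h' (u 0)] - Λ ![u 0] ![h.diff h' (u 1)], ?_, ?_⟩
  · refine isForm_two_zero
      (ψ := fun u v => Λ ![v] ![h.diff h' u] - Λ ![u] ![h.diff h' v]) ?_ ?_ ?_ ?_
    · intro u u' v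
      rw [diff_add, hf.single_add, hf.base_single_add]; ring
    · intro f u v
      rw [diff_fmul, hf.single_fmul, hf.base_single_fmul]; ring
    · exact fun u => sub_self _
    · exact fun u v => (neg_sub _ _).symm
  · apply cochain_ext_two_one
    intro u v w
    change _ = h'.dHor 1 1 Λ ![u, v] ![w] - h.dHor 1 1 Λ ![u, v] ![w]
    rw [dVer_zero_apply, dHor_one_apply, dHor_one_apply, lie_one_sub_lie_one h h' hΛ,
      lie_one_sub_lie_one h h' hΛ]
    simp only [Matrix.cons_val_zero, Matrix.cons_val_one, VF.act_sub]
    rw [neg_one_sq, one_smul]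
    ring

theorem dHor_two_sub_mem_exactForm {Λ : Cochain π 2 1} (hΛ : Λ ∈ closedForm π 2 1) :
    h'.dHor 2 1 Λ - h.dHor 2 1 Λ ∈ exactForm π 3 1 := by
  have hf : IsForm π Λ := hΛ.1
  refine ⟨fun u _ => Λ ![u 0, u 2] ![h.diff h' (u 1)] - Λ ![u 1, u 2] ![h.diff h' (u 0)]
    - Λ ![u 0, u 1] ![h.diff h' (u 2)], ?_, ?_⟩
  · refine isForm_three_zero (ψ := fun u v t => Λ ![u, t] ![h.diff h' v]
      - Λ ![v, t] ![h.diff h' u] - Λ ![u, v] ![h.diff h' t]) ?_ ?_ ?_ ?_ ?_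
    · intro u u' v t
      rw [diff_add, hf.single_add, hf.base_pair_add_left, hf.base_pair_add_left]; ring
    · intro f u v t
      rw [diff_fmul, hf.single_fmul, hf.base_pair_fmul_left, hf.base_pair_fmul_left]; ring
    · intro u t
      rw [hf.base_pair_self, sub_self, sub_zero]
    · intro u v t
      rw [hf.base_pair_swap v u]; ring
    · intro u v t
      rw [hf.base_pair_swap t v]; ring
  · apply cochain_ext_three_one
    intro u v t w
    change _ = h'.dHor 2 1 Λ ![u, v, t] ![w] - h.dHor 2 1 Λ ![u, v, t] ![w]
    rw [dVer_zero_apply, dHor_two_apply, dHor_two_apply, lie_one_sub_lie_one h h' hΛ,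
      lie_one_sub_lie_one h h' hΛ, lie_one_sub_lie_one h h' hΛ]
    have v2 : ![u, v, t] 2 = t := rfl
    simp only [Matrix.cons_val_zero, Matrix.cons_val_one, v2, VF.act_sub]
    rw [show (-1 : ℝ) ^ 3 = -1 by norm_num, neg_one_smul]
    ring

theorem Z2_le : h.Z2 2 1 ≤ h'.Z2 2 1 := by
  rintro _ ⟨Λ, hΛ, rfl⟩
  refine ⟨Λ, ?_, rfl⟩
  have h1 := (exactForm π 3 1).add_mem hΛ (dHor_two_sub_mem_exactForm h h' Λ.2)
  rwa [Submodule.subtype_apply, add_sub_cancel] at h1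

theorem mk_eq_mk_iff {p q : ℕ} (Λ Λ' : closedForm π p q) :
    E1.mk π p q Λ = E1.mk π p q Λ' ↔ (Λ : Cochain π p q) - Λ' ∈ exactForm π p q :=
  Submodule.Quotient.eq _

theorem B2_le : h.B2 2 1 ≤ h'.B2 2 1 := by
  rintro _ ⟨Λ, ⟨α, hα, e⟩, rfl⟩
  have h1 := dHor_one_sub_mem_exactForm h h' hα
  have h2 : h'.dHor 1 1 α ∈ closedForm π 2 1 := by
    have := (closedForm π 2 1).add_mem Λ.2 (exactForm_two_one_le h1)
    rw [← Submodule.subtype_apply, ← e, add_sub_cancel] at this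
    exact this
  refine ⟨⟨_, h2⟩, ⟨α, hα, rfl⟩, (mk_eq_mk_iff _ _).2 ?_⟩
  rw [e] at h1
  exact h1

theorem Z2_eq : h.Z2 2 1 = h'.Z2 2 1 := le_antisymm (Z2_le h h') (Z2_le h' h)

theorem B2_eq : h.B2 2 1 = h'.B2 2 1 := le_antisymm (B2_le h h') (B2_le h' h)

end Independence

/-! ### The curvature of a connection -/

section Curvature

variable (h : Connection π)

theorem lift_sub (u v : VF F B) : h.lift (u - v) = h.lift u - h.lift v := by
  rw [eq_sub_iff_add_eq, ← lift_add, sub_add_cancel]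

theorem lift_zero : h.lift 0 = 0 := by
  simpa using h.lift_sub 0 0

theorem lift_neg (u : VF F B) : h.lift (-u) = -h.lift u := by
  rw [← zero_sub, lift_sub, lift_zero, zero_sub]

theorem curvature_coe (u v : VF F B) :
    (h.curvature u v).1 = (h.lift u).bracket (h.lift v) - h.lift (u.bracket v) := rfl

theorem curvature_add_left (u u' v : VF F B) :
    h.curvature (u + u') v = h.curvature u v + h.curvature u' v := by
  apply Subtype.ext
  change (h.curvature (u + u') v).1 = (h.curvature u v).1 + (h.curvature u' v).1
  simp only [curvature_coe, lift_add, VF.bracket_add_left]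
  abel

theorem curvature_swap (u v : VF F B) : h.curvature u v = -h.curvature v u := by
  apply Subtype.ext
  change (h.curvature u v).1 = -(h.curvature v u).1
  rw [curvature_coe, curvature_coe, VF.bracket_swap, VF.bracket_swap u v, lift_neg]
  abel

theorem curvature_self (u : VF F B) : h.curvature u u = 0 := by
  apply Subtype.ext
  change (h.curvature u u).1 = 0
  rw [curvature_coe, VF.bracket_self, VF.bracket_self, lift_zero, sub_zero]

theorem _root_.SympFib.VF.bracket_fmul_left (f : Fn E M) (V W : VF E M) :
    (VF.fmul f V).bracket W = VF.fmul f (V.bracket W) - VF.fmul (W.act f) V := by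
  rw [VF.bracket_swap, VF.bracket_fmul_right, VF.bracket_swap W V]
  apply VF.ext
  intro x
  change -((W.act f x) • V x + f x • -(V.bracket W x)) = f x • V.bracket W x - W.act f x • V x
  rw [smul_neg]
  abel

theorem curvature_fmul_left (f : Fn F B) (u v : VF F B) :
    h.curvature (VF.fmul f u) v = Vert.fmul π (f.comp π) (h.curvature u v) := by
  apply Subtype.ext
  change (h.curvature (VF.fmul f u) v).1 = VF.fmul (f.comp π) (h.curvature u v).1
  rw [curvature_coe, curvature_coe, lift_fmul, VF.bracket_fmul_left, VF.bracket_fmul_left,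
    lift_sub, lift_fmul, lift_fmul, lift_act_comp]
  apply VF.ext
  intro x
  simp only [VF.sub_apply, VF.fmul_apply, smul_sub]
  abel

/-- The Bianchi identity. -/
theorem bianchi (u v t : VF F B) :
    h.lieV u (h.curvature v t) - h.lieV v (h.curvature u t) + h.lieV t (h.curvature u v)
      - h.curvature (u.bracket v) t + h.curvature (u.bracket t) v
      + h.curvature u (v.bracket t) = 0 := by
  apply Subtype.ext
  change (h.lift u).bracket (h.curvature v t).1 - (h.lift v).bracket (h.curvature u t).1
    + (h.lift t).bracket (h.curvature u v).1 - (h.curvature (u.bracket v) t).1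
    + (h.curvature (u.bracket t) v).1 + (h.curvature u (v.bracket t)).1 = 0
  simp only [curvature_coe, VF.bracket_sub_right]
  rw [VF.bracket_bracket (h.lift u) (h.lift v) (h.lift t), VF.bracket_bracket u v t, lift_add,
    VF.bracket_swap (h.lift t) ((h.lift u).bracket (h.lift v)),
    VF.bracket_swap (h.lift t) (h.lift (u.bracket v)),
    VF.bracket_swap (h.lift v) (h.lift (u.bracket t)),
    VF.bracket_swap v (u.bracket t)]
  rw [lift_neg]
  abel

end Curvature

end Connection

/-! ### Symplectic connections -/

section Symplectic

variable {σ : Cochain π 0 2}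

theorem IsForm.pair_sub_left (hσ : IsForm π σ) (a b c : Vert π) :
    σ ![] ![a - b, c] = σ ![] ![a, c] - σ ![] ![b, c] :=
  (hσ.pairLeft c).map_sub a b

theorem IsForm.pair_sub_right (hσ : IsForm π σ) (a b c : Vert π) :
    σ ![] ![a, b - c] = σ ![] ![a, b] - σ ![] ![a, c] :=
  (hσ.pairRight a).map_sub b c

/-- For closed `σ`, Cartan's formula says that a vertical field `X` preserves `σ` if and only if
the one-form `i_X σ` is closed. -/
theorem IsForm.lie_eq_zero_iff (hσ : IsForm π σ) (hc : dVer π 0 2 σ = 0) (X : Vert π) :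
    (∀ a b, X.1.act (σ ![] ![a, b]) =
      σ ![] ![Vert.bracket π X a, b] + σ ![] ![a, Vert.bracket π X b]) ↔
    ∀ a b, σ ![] ![X, Vert.bracket π a b] =
      a.1.act (σ ![] ![X, b]) - b.1.act (σ ![] ![X, a]) := by
  refine forall₂_congr fun a b => ?_
  have h1 := (dVer_two_apply σ ![] X a b).symm.trans (congrFun (congrFun hc ![]) ![X, a, b])
  change _ = (0 : Fn E M) at h1
  rw [hσ.pair_swap (Vert.bracket π X b) a] at h1
  constructor <;> intro h2
  · linear_combination h1 - h2
  · linear_combination h1 - h2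

namespace Connection

variable {h h' : Connection π}

/-- The commutator of two Lie derivatives along horizontal lifts. -/
theorem bracket_curvature (h : Connection π) (u v : VF F B) (a : Vert π) :
    Vert.bracket π (h.curvature u v) a =
      h.lieV u (h.lieV v a) - h.lieV v (h.lieV u a) - h.lieV (u.bracket v) a := by
  apply Subtype.ext
  change (h.curvature u v).1.bracket a.1 = (h.lift u).bracket ((h.lift v).bracket a.1) -
    (h.lift v).bracket ((h.lift u).bracket a.1) - (h.lift (u.bracket v)).bracket a.1
  rw [curvature_coe, VF.bracket_sub_left, VF.bracket_bracket (h.lift u) (h.lift v)]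
  abel

theorem IsSymplectic.lie_curvature (hs : h.IsSymplectic σ) (hσ : IsForm π σ) (u v : VF F B)
    (a b : Vert π) : (h.curvature u v).1.act (σ ![] ![a, b]) =
      σ ![] ![Vert.bracket π (h.curvature u v) a, b] +
        σ ![] ![a, Vert.bracket π (h.curvature u v) b] := by
  have hs' := h.isSymplectic_iff.1 hs
  rw [bracket_curvature, bracket_curvature, curvature_coe, VF.sub_act, VF.bracket_act]
  simp only [hs', VF.act_add, hσ.pair_sub_left, hσ.pair_sub_right]
  ring

theorem isForm_dCurv (h : Connection π) (hσ : IsForm π σ) : IsForm π (h.dCurv 0 1 σ) := by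
  have e : h.dCurv 0 1 σ = fun u w => -σ ![] ![h.curvature (u 0) (u 1), w 0] :=
    cochain_ext_two_one fun u v w => h.dCurv_apply σ u v w
  rw [e]
  refine isForm_two_one (Θ := fun u v w => -σ ![] ![h.curvature u v, w]) ?_ ?_ ?_ ?_ ?_ ?_
  · intro u u' v w
    rw [curvature_add_left, hσ.pair_add_left]; ring
  · intro f u v w
    rw [curvature_fmul_left, hσ.pair_fmul_left]; ring
  · intro u w
    rw [curvature_self]
    exact (congrArg Neg.neg (hσ.pairLeft w).map_zero).trans neg_zero
  · intro u v w
    rw [curvature_swap]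
    exact congrArg Neg.neg ((hσ.pairLeft w).map_neg _)
  · intro u v w w'
    rw [hσ.pair_add_right]; ring
  · intro u v f w
    rw [hσ.pair_fmul_right]; ring

theorem IsSymplectic.dCurv_mem_closedForm (hs : h.IsSymplectic σ) (hσ : IsForm π σ)
    (hc : dVer π 0 2 σ = 0) : h.dCurv 0 1 σ ∈ closedForm π 2 1 := by
  refine mem_closedForm_iff.2 ⟨h.isForm_dCurv hσ, fun u a b => ?_⟩
  rw [eta_two u, dCurv_apply, dCurv_apply, dCurv_apply,
    (hσ.lie_eq_zero_iff hc _).1 (hs.lie_curvature hσ _ _), VF.act_neg, VF.act_neg]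
  ring

/-- By the Bianchi identity `d_C σ` is `d_H`-closed. -/
theorem IsSymplectic.dHor_dCurv (hs : h.IsSymplectic σ) (hσ : IsForm π σ) :
    h.dHor 2 1 (h.dCurv 0 1 σ) = 0 := by
  have hs' := h.isSymplectic_iff.1 hs
  apply cochain_ext_three_one
  intro u v t w
  have hb := congrArg (hσ.pairLeft w) (h.bianchi u v t)
  simp only [map_add, map_sub, map_zero] at hb
  change σ ![] ![_, w] - σ ![] ![_, w] + σ ![] ![_, w] - σ ![] ![_, w] + σ ![] ![_, w] +
    σ ![] ![_, w] = 0 at hb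
  rw [dHor_two_apply]
  simp only [dCurv_apply, VF.act_neg, hs']
  change _ = (0 : Fn E M)
  linear_combination -hb

theorem IsSymplectic.mk_dCurv_mem_Z2 (hs : h.IsSymplectic σ) (hσ : IsForm π σ)
    (hc : dVer π 0 2 σ = 0) :
    E1.mk π 2 1 ⟨_, hs.dCurv_mem_closedForm hσ hc⟩ ∈ h.Z2 2 1 := by
  refine ⟨⟨_, hs.dCurv_mem_closedForm hσ hc⟩, ?_, rfl⟩
  change h.dHor 2 1 (h.dCurv 0 1 σ) ∈ exactForm π 3 1
  rw [hs.dHor_dCurv hσ]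
  exact Submodule.zero_mem _

/-- A connection `h'` is symplectic along with `h` if and only if the one-forms `i_A σ`,
`A = h'(u) - h(u)`, are closed. -/
theorem IsSymplectic.iff_closed_diff (hs : h.IsSymplectic σ) (hσ : IsForm π σ)
    (hc : dVer π 0 2 σ = 0) : h'.IsSymplectic σ ↔ ∀ u a b,
      σ ![] ![h.diff h' u, Vert.bracket π a b] =
        a.1.act (σ ![] ![h.diff h' u, b]) - b.1.act (σ ![] ![h.diff h' u, a]) := by
  have hs' := h.isSymplectic_iff.1 hs
  rw [isSymplectic_iff]
  refine forall_congr' fun u => ?_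
  rw [← hσ.lie_eq_zero_iff hc]
  refine forall₂_congr fun a b => ?_
  rw [lieV_eq_add_diff h h', lieV_eq_add_diff h h', hσ.pair_add_left, hσ.pair_add_right,
    lift_eq_add_diff h h', VF.add_act, hs']
  constructor <;> intro h2
  · linear_combination h2
  · linear_combination h2

/-- The form `u ↦ i_{h'(u) - h(u)} σ` in `Ω¹(B, Ω¹(Ver))`. -/
def diffForm (h h' : Connection π) (σ : Cochain π 0 2) : Cochain π 1 1 :=
  fun u w => σ ![] ![h.diff h' (u 0), w 0]

/-- The form `(u, v) ↦ σ(h'(u) - h(u), h'(v) - h(v))` in `Ω²(B, C^∞(M))`. -/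
def diffPair (h h' : Connection π) (σ : Cochain π 0 2) : Cochain π 2 0 :=
  fun u _ => σ ![] ![h.diff h' (u 0), h.diff h' (u 1)]

theorem diffForm_mem_closedForm (hσ : IsForm π σ) (hd : ∀ u a b,
      σ ![] ![h.diff h' u, Vert.bracket π a b] =
        a.1.act (σ ![] ![h.diff h' u, b]) - b.1.act (σ ![] ![h.diff h' u, a])) :
    h.diffForm h' σ ∈ closedForm π 1 1 := by
  refine mem_closedForm_iff.2 ⟨?_, fun u a b => hd (u 0) a b⟩
  refine isForm_one_one (α := fun u w => σ ![] ![h.diff h' u, w]) ?_ ?_ ?_ ?_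
  · intro u v w
    rw [diff_add, hσ.pair_add_left]
  · intro f u w
    rw [diff_fmul, hσ.pair_fmul_left]
  · exact fun u w w' => hσ.pair_add_right _ _ _
  · exact fun u f w => hσ.pair_fmul_right _ _ _

theorem diffPair_mem_form (h h' : Connection π) (hσ : IsForm π σ) :
    h.diffPair h' σ ∈ Form π 2 0 := by
  refine isForm_two_zero (ψ := fun u v => σ ![] ![h.diff h' u, h.diff h' v]) ?_ ?_ ?_ ?_
  · intro u u' v
    rw [diff_add, hσ.pair_add_left]
  · intro f u v
    rw [diff_fmul, hσ.pair_fmul_left]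
  · exact fun u => hσ.pair_self _
  · exact fun u v => hσ.pair_swap _ _

theorem curvature_eq_add_diff (h h' : Connection π) (u v : VF F B) :
    h'.curvature u v = h.curvature u v + h.lieV u (h.diff h' v) - h.lieV v (h.diff h' u)
      - h.diff h' (u.bracket v) + Vert.bracket π (h.diff h' u) (h.diff h' v) := by
  apply Subtype.ext
  change (h'.curvature u v).1 = (h.curvature u v).1 + (h.lift u).bracket (h.diff h' v).1 -
    (h.lift v).bracket (h.diff h' u).1 - (h.diff h' (u.bracket v)).1 +
    (h.diff h' u).1.bracket (h.diff h' v).1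
  rw [curvature_coe, curvature_coe, lift_eq_add_diff h h' u, lift_eq_add_diff h h' v,
    lift_eq_add_diff h h' (u.bracket v), VF.bracket_add_left, VF.bracket_add_right,
    VF.bracket_add_right, VF.bracket_swap (h.lift v)]
  abel

/-- How `d_C σ` changes with the symplectic connection. -/
theorem IsSymplectic.dCurv_eq (hs : h.IsSymplectic σ) (hσ : IsForm π σ)
    (hc : dVer π 0 2 σ = 0) (hd : ∀ u a b,
      σ ![] ![h.diff h' u, Vert.bracket π a b] =
        a.1.act (σ ![] ![h.diff h' u, b]) - b.1.act (σ ![] ![h.diff h' u, a])) :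
    h'.dCurv 0 1 σ =
      h.dCurv 0 1 σ - h.dHor 1 1 (h.diffForm h' σ) + dVer π 2 0 (h.diffPair h' σ) := by
  have hs' := h.isSymplectic_iff.1 hs
  apply cochain_ext_two_one
  intro u v w
  change _ = h.dCurv 0 1 σ ![u, v] ![w] - h.dHor 1 1 (h.diffForm h' σ) ![u, v] ![w] +
    dVer π 2 0 (h.diffPair h' σ) ![u, v] ![w]
  rw [dCurv_apply, dCurv_apply, dHor_one_apply, dVer_zero_apply, neg_one_sq, one_smul,
    curvature_eq_add_diff h h', hσ.pair_add_left, hσ.pair_sub_left, hσ.pair_sub_left,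
    hσ.pair_add_left]
  simp only [diffForm, diffPair, Matrix.cons_val_zero, Matrix.cons_val_one]
  rw [hs', hs', hσ.pair_swap (h.diff h' u) (h.diff h' v), VF.act_neg]
  linear_combination hd v (h.diff h' u) w +
    (hσ.lie_eq_zero_iff hc (h.diff h' u)).2 (hd u) (h.diff h' v) w

/-- The connection with horizontal lifts `h(u) + A(u)`. -/
def translate [T2Space B] (h : Connection π) (A : VF F B →+ Vert π)
    (hA : ∀ f u, A (VF.fmul f u) = Vert.fmul π (f.comp π) (A u)) : Connection π where
  hor x :=
    { carrier := {v | ∃ u : VF F B, h.lift u x + (A u).1 x = v}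
      add_mem' := by
        rintro _ _ ⟨u, rfl⟩ ⟨v, rfl⟩
        refine ⟨u + v, ?_⟩
        rw [h.lift_add, A.map_add]
        exact add_add_add_comm _ _ _ _
      zero_mem' := ⟨0, by
        rw [h.lift_zero, A.map_zero]
        exact add_zero _⟩
      smul_mem' := by
        rintro c _ ⟨u, rfl⟩
        refine ⟨VF.fmul (algebraMap ℝ (Fn F B) c) u, ?_⟩
        rw [h.lift_fmul, hA]
        exact (smul_add _ _ _).symm }
  isCompl x := by
    have hproj : ∀ u, mfderiv 𝓘(ℝ, E) 𝓘(ℝ, F) π x (h.lift u x + (A u).1 x) = u (π x) := by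
      intro u
      rw [map_add, h.mfderiv_lift, (A u).2 x, add_zero]
    constructor
    · rw [Submodule.disjoint_def]
      rintro _ hv ⟨u, rfl⟩
      have hu : u (π x) = 0 := (hproj u).symm.trans hv
      have h1 : h.lift u x = 0 := h.eq_of_mem_of_mfderiv_eq (h.lift_mem u x)
        (h.hor x).zero_mem (by rw [h.mfderiv_lift, hu, map_zero])
      have h2 : (A u).1 x = 0 := VF.map_eq_zero_of_apply_eq_zero (π x)
        (AddMonoidHom.mk' (fun u => (A u).1 x) fun u v => by rw [A.map_add]; rfl)
        (fun f u => by
          change (A (VF.fmul f u)).1 x = _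
          rw [hA]; rfl) hu
      rw [h1, h2, add_zero]
    · rw [codisjoint_iff, eq_top_iff]
      intro v _
      obtain ⟨u, hu⟩ := VF.exists_apply_eq (π x) (mfderiv 𝓘(ℝ, E) 𝓘(ℝ, F) π x v)
      refine Submodule.mem_sup.2 ⟨v - (h.lift u x + (A u).1 x), ?_, h.lift u x + (A u).1 x,
        ⟨u, rfl⟩, sub_add_cancel _ _⟩
      change mfderiv 𝓘(ℝ, E) 𝓘(ℝ, F) π x (v - (h.lift u x + (A u).1 x)) = 0
      rw [map_sub, hproj, hu, sub_self]
  exists_lift u := ⟨h.lift u + (A u).1, fun x => ⟨⟨u, rfl⟩, by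
    rw [VF.add_apply, map_add, h.mfderiv_lift, (A u).2 x, add_zero]⟩⟩

theorem diff_translate [T2Space B] (h : Connection π) (A : VF F B →+ Vert π)
    (hA : ∀ f u, A (VF.fmul f u) = Vert.fmul π (f.comp π) (A u)) (u : VF F B) :
    h.diff (h.translate A hA) u = A u := by
  apply Subtype.ext
  change (h.translate A hA).lift u - h.lift u = (A u).1
  rw [(h.translate A hA).lift_eq_of_mem (X := h.lift u + (A u).1) (fun x => ⟨u, rfl⟩) fun x => by
    rw [VF.add_apply, map_add, h.mfderiv_lift, (A u).2 x, add_zero], add_sub_cancel_left]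

/-- Every closed `α ∈ Ω¹(B, Ω¹(Ver))` is the difference of `h` and another connection. -/
theorem exists_diffForm_eq [T2Space M] [T2Space B] (h : Connection π) (hσ : IsForm π σ)
    (nd : IsNondegenerate π σ) {α : Cochain π 1 1} (hα : IsForm π α) :
    ∃ h' : Connection π, h.diffForm h' σ = α := by
  choose A hA using fun u : VF F B =>
    hσ.exists_pair_eq h nd (hα.single ![u]) fun f w => hα.single_fmul ![u] f w
  have hA' : ∀ u w, σ ![] ![A u, w] = α ![u] ![w] := hA
  let A' : VF F B →+ Vert π := AddMonoidHom.mk' A fun u v => hσ.eq_of_pair_eq nd fun w => by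
    rw [hσ.pair_add_left, hA', hA', hA', hα.base_single_add]
  have hf : ∀ f u, A' (VF.fmul f u) = Vert.fmul π (f.comp π) (A' u) := fun f u =>
    hσ.eq_of_pair_eq nd fun w => by
      change σ ![] ![A (VF.fmul f u), w] = σ ![] ![Vert.fmul π (f.comp π) (A u), w]
      rw [hσ.pair_fmul_left, hA', hA', hα.base_single_fmul]
  refine ⟨h.translate A' hf, cochain_ext_one_one fun u w => ?_⟩
  change σ ![] ![h.diff (h.translate A' hf) u, w] = _
  rw [diff_translate]
  exact hA' u w

/-- The classes in `E_1` of `d_C σ` for two symplectic connections differ by a coboundary. -/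
theorem IsSymplectic.mk_dCurv_sub_mem_B2 (hs : h.IsSymplectic σ) (hs' : h'.IsSymplectic σ)
    (hσ : IsForm π σ) (hc : dVer π 0 2 σ = 0) :
    E1.mk π 2 1 ⟨_, hs.dCurv_mem_closedForm hσ hc⟩ -
      E1.mk π 2 1 ⟨_, hs'.dCurv_mem_closedForm hσ hc⟩ ∈ h.B2 2 1 := by
  have hd := (hs.iff_closed_diff hσ hc).1 hs'
  have e := hs.dCurv_eq hσ hc hd
  have hx : dVer π 2 0 (h.diffPair h' σ) ∈ exactForm π 2 1 :=
    ⟨_, h.diffPair_mem_form h' hσ, rfl⟩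
  have e' : h.dHor 1 1 (h.diffForm h' σ) =
      h.dCurv 0 1 σ - h'.dCurv 0 1 σ + dVer π 2 0 (h.diffPair h' σ) := by
    rw [e]; abel
  have hm : h.dHor 1 1 (h.diffForm h' σ) ∈ closedForm π 2 1 := by
    rw [e']
    exact (closedForm π 2 1).add_mem ((closedForm π 2 1).sub_mem
      (hs.dCurv_mem_closedForm hσ hc) (hs'.dCurv_mem_closedForm hσ hc)) (exactForm_two_one_le hx)
  refine ⟨⟨_, hm⟩, ⟨_, diffForm_mem_closedForm hσ hd, rfl⟩, ?_⟩
  rw [← map_sub, mk_eq_mk_iff]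
  change h.dHor 1 1 (h.diffForm h' σ) - (h.dCurv 0 1 σ - h'.dCurv 0 1 σ) ∈ _
  rw [e', add_sub_cancel_left]
  exact hx

/-- If `d_C σ` is `d_H α` up to a `d_V`-exact form, then the connection `h + A` with `i_A σ = α` is
symplectic with hamiltonian curvature; the converse is the comparison of two connections. -/
theorem IsSymplectic.mk_dCurv_mem_B2_iff [T2Space M] [T2Space B] (hs : h.IsSymplectic σ)
    (hσ : IsForm π σ) (hc : dVer π 0 2 σ = 0) (nd : IsNondegenerate π σ) :
    E1.mk π 2 1 ⟨_, hs.dCurv_mem_closedForm hσ hc⟩ ∈ h.B2 2 1 ↔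
      ∃ h' : Connection π, h'.IsSymplectic σ ∧ h'.HasHamiltonianCurvature σ := by
  constructor
  · rintro ⟨Λ, ⟨α, hα, e⟩, hΛ⟩
    obtain ⟨ψ, hψ, hψe⟩ := (mk_eq_mk_iff _ _).1 hΛ
    obtain ⟨h', rfl⟩ := h.exists_diffForm_eq hσ nd hα.1
    have hd : ∀ u a b, σ ![] ![h.diff h' u, Vert.bracket π a b] =
        a.1.act (σ ![] ![h.diff h' u, b]) - b.1.act (σ ![] ![h.diff h' u, a]) :=
      fun u => (mem_closedForm_iff.1 hα).2 ![u]
    refine ⟨h', (hs.iff_closed_diff hσ hc).2 hd, ψ - h.diffPair h' σ,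
      (Form π 2 0).sub_mem hψ (h.diffPair_mem_form h' hσ), ?_⟩
    have e2 : h.dHor 1 1 (h.diffForm h' σ) = Λ := e
    rw [hs.dCurv_eq hσ hc hd, map_sub, hψe, e2]
    abel
  · rintro ⟨h', hs', ψ, hψ, hH⟩
    have h1 : E1.mk π 2 1 ⟨_, hs'.dCurv_mem_closedForm hσ hc⟩ = 0 := by
      rw [← map_zero (E1.mk π 2 1), mk_eq_mk_iff]
      refine ⟨-ψ, (Form π 2 0).neg_mem hψ, ?_⟩
      rw [map_neg]
      exact (eq_neg_of_add_eq_zero_left hH).symm.trans (sub_zero _).symm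
    have h2 := hs.mk_dCurv_sub_mem_B2 hs' hσ hc
    rwa [h1, sub_zero] at h2

end Connection

end Symplectic

/-! ### Classes in `E_2` -/

theorem mkQ_comap_eq_iff {N : Type*} [AddCommGroup N] [Module ℝ N] {Z B : Submodule ℝ N}
    (x y : Z) : (B.comap Z.subtype).mkQ x = (B.comap Z.subtype).mkQ y ↔ (x : N) - y ∈ B :=
  Submodule.Quotient.eq _

theorem mkQ_comap_eq_zero_iff {N : Type*} [AddCommGroup N] [Module ℝ N] {Z B : Submodule ℝ N}
    (x : Z) : (B.comap Z.subtype).mkQ x = 0 ↔ (x : N) ∈ B :=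
  Submodule.Quotient.mk_eq_zero _

theorem Connection.HasClass.eq {h : Connection π} {p q : ℕ} {Λ : Cochain π p q} {c : h.E2 p q}
    (hcl : h.HasClass Λ c) (hΛ : Λ ∈ closedForm π p q)
    (hz : E1.mk π p q ⟨Λ, hΛ⟩ ∈ h.Z2 p q) :
    c = ((h.B2 p q).comap (h.Z2 p q).subtype).mkQ ⟨E1.mk π p q ⟨Λ, hΛ⟩, hz⟩ :=
  hcl.elim fun _ hcl' => hcl'.elim fun _ e => e

end

end SympFib

end

open scoped Manifold ContDiff
open SympFib
theorem mainTheorem2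
    {E : Type*} [NormedAddCommGroup E] [NormedSpace ℝ E] [FiniteDimensional ℝ E]
    {F : Type*} [NormedAddCommGroup F] [NormedSpace ℝ F] [FiniteDimensional ℝ F]
    {M : Type*} [TopologicalSpace M] [ChartedSpace E M] [IsManifold 𝓘(ℝ, E) ∞ M]
    [T2Space M] [SecondCountableTopology M]
    {B : Type*} [TopologicalSpace B] [ChartedSpace F B] [IsManifold 𝓘(ℝ, F) ∞ B]
    [T2Space B] [SecondCountableTopology B]
    (π : C^∞⟮𝓘(ℝ, E), M; 𝓘(ℝ, F), B⟯) (σ : Cochain π 0 2)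
    (hσ : IsSymplecticFibration π σ) (hconn : ∀ b : B, IsConnected (π ⁻¹' {b})) :
    -- `H²(B, H¹(Ver))` does not depend on the connection used to compute it
    (∀ h h' : Connection π, h.Z2 2 1 = h'.Z2 2 1 ∧ h.B2 2 1 = h'.B2 2 1) ∧
    -- the class is well defined and does not depend on the symplectic connection
    (∀ h₀ : Connection π, ∃! c : h₀.E2 2 1,
      ∀ h : Connection π, h.IsSymplectic σ → h₀.HasClass (h.dCurv 0 1 σ) c) ∧
    -- it vanishes iff there is a symplectic connection with hamiltonian curvature
    (∀ (h₀ : Connection π) (c : h₀.E2 2 1),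
      (∀ h : Connection π, h.IsSymplectic σ → h₀.HasClass (h.dCurv 0 1 σ) c) →
        (c = 0 ↔ ∃ h : Connection π, h.IsSymplectic σ ∧ h.HasHamiltonianCurvature σ)) := by
  obtain ⟨h₁, -, hs₁⟩ := hσ.exists_symplectic
  have hf : IsForm π σ := hσ.mem_form
  have hc := hσ.closed
  have hz : ∀ (h₀ : Connection π) {h : Connection π} (hs : h.IsSymplectic σ),
      E1.mk π 2 1 ⟨_, hs.dCurv_mem_closedForm hf hc⟩ ∈ h₀.Z2 2 1 := fun h₀ h hs =>
    Connection.Z2_eq h h₀ ▸ hs.mk_dCurv_mem_Z2 hf hc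
  refine ⟨fun h h' => ⟨Connection.Z2_eq h h', Connection.B2_eq h h'⟩, fun h₀ => ?_,
    fun h₀ c hcl => ?_⟩
  · refine ⟨((h₀.B2 2 1).comap (h₀.Z2 2 1).subtype).mkQ ⟨_, hz h₀ hs₁⟩, fun h hs =>
      ⟨hs.dCurv_mem_closedForm hf hc, hz h₀ hs, ?_⟩, fun c hcl => ?_⟩
    · rw [mkQ_comap_eq_iff, Connection.B2_eq h₀ h₁]
      exact hs₁.mk_dCurv_sub_mem_B2 hs hf hc
    · exact (hcl h₁ hs₁).eq _ _
  · rw [← hs₁.mk_dCurv_mem_B2_iff hf hc hσ.nondegenerate, Connection.B2_eq h₁ h₀,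
      (hcl h₁ hs₁).eq (hs₁.dCurv_mem_closedForm hf hc) (hz h₀ hs₁)]
    exact mkQ_comap_eq_zero_iff _
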